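/- **Setting.** Let $\omega=\{0,1,2,\dots\}$ and let $a_0,a_1,\dots$ be attributes. A decision rule $r$ is an expression $(a_{i_1}=\delta_1)\wedge\dots\wedge(a_{i_m}=\delta_m)\to\sigma$ with pairwise different attributes, $m\ge 0$ and $\delta_j,\sigma\in\omega$; $m$ is its length, $A(r)$ the set of its attributes, $K(r)$ the set of its equations; rules are equal iff $K(r)$ and $\sigma$ agree. Let $S$ be a finite set of rules, $A(S)=\bigcup_{r\in S}A(r)$, $d(S)$ the maximum length of a rule of $S$ ($d(\emptyset)=0$), $V_S(a)$ the set of $\delta$ such that $a=\delta$ occurs in $S$, $EV_S(a)=V_S(a)\cup\{*\}$. $V(S)$ and $EV(S)$ are the sets of tuples $\bar\delta=(\delta_a)_{a\in A(S)}$ with $\delta_a\in V_S(a)$, respectively $\delta_a\in EV_S(a)$. An equation system is consistent if it gives no attribute two different values. An o-tree (e-tree) over $S$ is a finite rooted tree whose working nodes are labeled with attributes $a\in A(S)$, with exactly one edge leaving for each element of $V_S(a)$ (of $EV_S(a)$), and whose terminal nodes are labeled with subsets of $S$; its depth $h(\Gamma)$ is the maximum number of working nodes on a complete path. For a complete path $\xi$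 let $K(\xi)$ be its equation system and $\tau(\xi)$ its terminal label. A tree solves $AR(S)$, $AD(S)$, $SR(S)$ (o-trees), or $EAR(S)$, $EAD(S)$, $ESR(S)$ (e-trees), if for every complete path $\xi$ with $K(\xi)$ consistent, $K(r)\subseteq K(\xi)$ for all $r\in\tau(\xi)$ and, respectively: (AR) $K(r)\cup K(\xi)$ is inconsistent for every $r\in S\setminus\tau(\xi)$; (AD) the same for those $r\in S\setminus\tau(\xi)$ whose right-hand side is not a right-hand side of a rule of $\tau(\xi)$; (SR) if $\tau(\xi)=\emptyset$, then $K(r)\cup K(\xi)$ is inconsistent for every $r\in S$. Let $h_C(S)$ be the minimum depth of a tree solving $C(S)$. For a consistent system $\alpha$, $S_\alpha$ consists of the rules of $S$ consistent with $\alpha$, with the equations of $\alpha$ removed from their left-hand sides. $I_{ESR}(S)$ is the set of rules of length $0$ if there are any, and $S$ otherwise; $I_{EAD}(S)$ consists of the rules of length $0$ and of the rules whose right-hand side is not the right-hand side of a rule of length $0$; $I_C(S)=S$ for the other $C$. $R_{ESR}(S)$ is the set of $r\in S$ such that no $r'\in S$ has $K(r')\subsetneq K(r)$; $R_{EAD}(S)$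 is defined in the same way with $r'$ restricted to the rules with the right-hand side of $r$. $S^+$ is the set of rules of $S$ of length $d(S)$. A node cover of $S$ is a set $B\subseteq A(S)$ meeting every nonempty $A(r)$, $r\in S$; $\beta(S)$ is its minimum size. $\beta^+_C(S)$ is the maximum of $\beta\big(I_C(S_\alpha)^+\big)$ over all consistent systems $\alpha$ of equations $a=\delta$ with $a\in A(S)$ and $\delta\in V_S(a)$ for $C\in\{AR,AD,SR\}$, $\delta\in EV_S(a)$ for $C\in\{EAR,EAD,ESR\}$. **Algorithms.** *Greedy cover:* while rules of $S^+$ remain, choose one, $r$, add $A(r)$ to $B$, and remove all rules $r'$ with $A(r')\cap A(r)\ne\emptyset$. *$\mathcal A_{tree}^C$ ($C\in\{AR,EAR\}$) and $\mathcal B_{tree}^C$ ($C\in\{EAD,ESR\}$)* on a tuple work in rounds: if $\alpha$ is the system of the equations computed so far and all rules of $I_C(S_\alpha)$ (if any) have length $0$, finish; otherwise compute the values of all attributes of a greedy cover of $I_C(S_\alpha)^+$. The result of $\mathcal A_{tree}^C$ is the set of $r\in S$ with $K(r)\cup\alpha$ consistent; the result of $\mathcal B_{tree}^C$ is the set of those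 among them all of whose attributes have been computed. To adapt $\mathcal B_{tree}^C$ for $S'=R_C(S)$ to tuples from $EV(S)$, treat each value $\delta_a\notin EV_{S'}(a)$ as $*$. An algorithm *describes the work of $\Gamma$* if, for $S$ and a tuple $\bar\delta$ from $V(S)$ (o-tree) or $EV(S)$ (e-tree), it outputs the complete path of $\Gamma$ for $\bar\delta$ (attributes and values, in order) and its terminal label. Inputs are finite lists, with numbers in binary; time is polynomial in the input size. **Theorem.** 1. For every $S$ with $A(S)\ne\emptyset$, every greedy cover $B$ of $S^+$ is a node cover of $S^+$ with $|B|\le\beta(S^+)\,d(S)$; there is a polynomial-time algorithm that, given $S$ with $A(S)\neq\emptyset$, constructs a greedy cover of $S^+$. 2. In each of the following cases there is a polynomial-time algorithm such that, for every $S$ with $A(S)\ne\emptyset$ (given as a list of its rules), there is a decision tree $\Gamma$ over $S$, independent of the tuple, whose work the algorithm describes on every tuple, each described path and terminal label being a run of the procedure named, and with the properties stated: (a) $\mathcal A_{tree}^{AR}$: $\Gamma$ solves $AR(S)$, $AD(S)$ and $SR(S)$; $h(\Gamma)\le d(S)^2\beta^+_{C}(S)$ for $C=AR,AD,SR$; and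 $h(\Gamma)\le h_{AR}(S)^3$. (b) $\mathcal A_{tree}^{EAR}$: $\Gamma$ solves $EAR(S)$, $h(\Gamma)\le d(S)^2\beta^+_{EAR}(S)$, and $h(\Gamma)\le h_{EAR}(S)^3$. (c) $\mathcal B_{tree}^{C}$, for each $C\in\{EAD,ESR\}$: $\Gamma$ solves $C(S)$ and $h(\Gamma)\le d(I_C(S))^2\beta^+_C(S)$. (d) $\mathcal B_{tree}^{C}$ for $S'=R_C(S)$, adapted to tuples from $EV(S)$, for each $C\in\{EAD,ESR\}$: $\Gamma$ is a tree over $S$ that solves $C(S)$, $h(\Gamma)\le d(I_C(S'))^2\beta^+_C(S')$, and $h(\Gamma)\le h_C(S)^3$. -/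

import Mathlib

namespace DecisionRules

/-! ## Decision rule systems

The attribute `a_i` is represented by its index `i : ℕ`. A value from `ω ∪ {*}` is an element of
`Option ℕ`, where `none` is the symbol `*`. An equation `a_i = δ` is a pair `(i, δ)`. -/

/-- A decision rule `(a_{i₁} = δ₁) ∧ ⋯ ∧ (a_{iₘ} = δₘ) → σ` with pairwise different attributes.
Two rules are equal iff their sets of equations and their right-hand sides are equal. -/
@[ext] structure Rule where
  lhs : Finset (ℕ × ℕ)
  rhs : ℕ
  distinct : ∀ e ∈ lhs, ∀ e' ∈ lhs, e.1 = e'.1 → e = e'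

instance : DecidableEq Rule := fun r s =>
  decidable_of_iff (r.lhs = s.lhs ∧ r.rhs = s.rhs) Rule.ext_iff.symm

/-- The length of a rule. -/
def Rule.length (r : Rule) : ℕ := r.lhs.card

/-- The set `A(r)`. -/
def Rule.attrs (r : Rule) : Finset ℕ := r.lhs.image Prod.fst

/-- An equation system with values in `ω ∪ {*}`. -/
abbrev EqSystem := Finset (ℕ × Option ℕ)

/-- The equation system `K(r)`. -/
def Rule.eqs (r : Rule) : EqSystem := r.lhs.image fun e => (e.1, some e.2)

/-- No attribute gets two different values. -/
def Consistent (E : EqSystem) : Prop := ∀ e ∈ E, ∀ e' ∈ E, e.1 = e'.1 → e.2 = e'.2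

instance : DecidablePred Consistent := fun E =>
  inferInstanceAs (Decidable (∀ e ∈ E, ∀ e' ∈ E, e.1 = e'.1 → e.2 = e'.2))

/-- The set `A(S)`. -/
def attributes (S : Finset Rule) : Finset ℕ := S.biUnion Rule.attrs

/-- The maximum length `d(S)` of a rule from `S` (`0` for the empty set of rules). -/
def maxLen (S : Finset Rule) : ℕ := S.sup Rule.length

/-- `V_S(a)` if `ext = false`, and `EV_S(a) = V_S(a) ∪ {*}` if `ext = true`. -/
def values (S : Finset Rule) (ext : Bool) (a : ℕ) : Finset (Option ℕ) :=
  (((S.biUnion Rule.lhs).filter fun e => e.1 = a).image fun e => some e.2) ∪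
    (if ext then {none} else ∅)

/-- The tuple `(δ a)`, `a ∈ A(S)`, belongs to `V(S)` (if `ext = false`), to `EV(S)`
(if `ext = true`). Values of `δ` outside `A(S)` play no role. -/
def IsTuple (S : Finset Rule) (ext : Bool) (δ : ℕ → Option ℕ) : Prop :=
  ∀ a ∈ attributes S, δ a ∈ values S ext a

/-- The equation system `{a = δ a : a ∈ Q}`. -/
def tupleEqs (δ : ℕ → Option ℕ) (Q : Finset ℕ) : EqSystem := Q.image fun a => (a, δ a)

/-- The rule `r_α`: the equations that belong to `α` are removed from the left-hand side. -/
def Rule.remove (r : Rule) (α : EqSystem) : Rule where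
  lhs := r.lhs.filter fun e => (e.1, some e.2) ∉ α
  rhs := r.rhs
  distinct := fun e he e' he' h =>
    r.distinct e (Finset.mem_filter.1 he).1 e' (Finset.mem_filter.1 he').1 h

/-- The set of rules `S_α`. -/
def restrict (S : Finset Rule) (α : EqSystem) : Finset Rule :=
  (S.filter fun r => Consistent (r.eqs ∪ α)).image fun r => r.remove α

/-- `R_SR(S)`: rules `r` such that no rule `r'` of `S` has `K(r') ⊂ K(r)` (strictly). -/
def reduceSR (S : Finset Rule) : Finset Rule :=
  S.filter fun r => ∀ r' ∈ S, ¬ r'.lhs ⊂ r.lhs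

/-- `R_AD(S)`: rules `r` such that no rule `r'` of `S` with the same right-hand side has
`K(r') ⊂ K(r)` (strictly). -/
def reduceAD (S : Finset Rule) : Finset Rule :=
  S.filter fun r => ∀ r' ∈ S, r'.rhs = r.rhs → ¬ r'.lhs ⊂ r.lhs

/-- `I_SR(S)`. -/
def innerSR (S : Finset Rule) : Finset Rule :=
  if ∀ r ∈ S, r.length ≠ 0 then S else S.filter fun r => r.length = 0

/-- `I_AD(S)`: the rules of length `0`, and the rules whose right-hand side is not the
right-hand side of a rule of length `0`. -/
def innerAD (S : Finset Rule) : Finset Rule :=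
  S.filter fun r => r.length = 0 ∨ ∀ r' ∈ S, r'.length = 0 → r'.rhs ≠ r.rhs

/-! ## Problems and decision trees -/

inductive Problem
  | AR | EAR | AD | EAD | SR | ESR

/-- Whether the problem is about extended tuples and extended trees. -/
def Problem.ext : Problem → Bool
  | .AR | .AD | .SR => false
  | .EAR | .EAD | .ESR => true

/-- `I_C(S)` for `C ∈ {EAD, ESR}`, and `S` for the other problems. -/
def Problem.inner : Problem → Finset Rule → Finset Rule
  | .EAD, S => innerAD S
  | .ESR, S => innerSR S
  | _, S => S

/-- `R_AD(S)` for `EAD`, `R_SR(S)` for `ESR`, and `S` for the other problems. -/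
def Problem.reduce : Problem → Finset Rule → Finset Rule
  | .EAD, S => reduceAD S
  | .ESR, S => reduceSR S
  | _, S => S

/-- Decision trees over `S`: o-trees if `ext = false`, e-trees if `ext = true`. A terminal node is
labeled with a subset of `S`; a working node is labeled with an attribute `a ∈ A(S)`, and exactly
one edge leaves it for each element of `V_S(a)` (of `EV_S(a)`, respectively). -/
inductive DTree (S : Finset Rule) (ext : Bool) : Type
  | leaf (τ : Finset Rule) (h : τ ⊆ S) : DTree S ext
  | node (a : ℕ) (ha : a ∈ attributes S)
      (child : {v : Option ℕ // v ∈ values S ext a} → DTree S ext) : DTree S ext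

namespace DTree

variable {S : Finset Rule} {ext : Bool}

/-- The depth: the maximum number of working nodes in a complete path. -/
def depth : DTree S ext → ℕ
  | leaf _ _ => 0
  | node _ _ child => (Finset.univ.sup fun v => (child v).depth) + 1

/-- `Γ.IsPath ξ τ`: the tree `Γ` has a complete path whose successive working nodes and edges are
labeled with the attributes and values listed in `ξ`, and whose terminal node is labeled with
`τ`. -/
inductive IsPath : DTree S ext → List (ℕ × Option ℕ) → Finset Rule → Prop
  | leaf (τ : Finset Rule) (h : τ ⊆ S) : IsPath (.leaf τ h) [] τ
  | node (a : ℕ) (ha : a ∈ attributes S)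
      (child : {v : Option ℕ // v ∈ values S ext a} → DTree S ext)
      (v : {v : Option ℕ // v ∈ values S ext a}) (ξ : List (ℕ × Option ℕ)) (τ : Finset Rule) :
      IsPath (child v) ξ τ → IsPath (.node a ha child) ((a, v.1) :: ξ) τ

end DTree

/-- The requirement that the problem `C` puts on a rule set `τ` attached to the end of a complete
path with equation system `K`. -/
def Problem.Accepts (C : Problem) (S : Finset Rule) (K : EqSystem) (τ : Finset Rule) : Prop :=
  (∀ r ∈ τ, r.eqs ⊆ K) ∧
  match C with
  | .AR | .EAR => ∀ r ∈ S \ τ, ¬ Consistent (r.eqs ∪ K)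
  | .AD | .EAD => ∀ r ∈ S \ τ, r.rhs ∉ τ.image Rule.rhs → ¬ Consistent (r.eqs ∪ K)
  | .SR | .ESR => τ = ∅ → ∀ r ∈ S, ¬ Consistent (r.eqs ∪ K)

/-- The tree `Γ` solves the problem `C(S)`; it must be an o-tree or an e-tree as `C` demands. -/
def DTree.Solves {S : Finset Rule} {ext : Bool} (Γ : DTree S ext) (C : Problem) : Prop :=
  ext = C.ext ∧
  ∀ (ξ : List (ℕ × Option ℕ)) (τ : Finset Rule), Γ.IsPath ξ τ → Consistent ξ.toFinset →
    C.Accepts S ξ.toFinset τ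

/-- `h_C(S)`: the minimum depth of a decision tree over `S` solving the problem `C(S)`. -/
noncomputable def minDepth (C : Problem) (S : Finset Rule) : ℕ :=
  sInf {h : ℕ | ∃ Γ : DTree S C.ext, Γ.Solves C ∧ Γ.depth = h}

/-! ## Node covers -/

/-- `B` is a node cover of the hypergraph `G(S)`. -/
def IsNodeCover (S : Finset Rule) (B : Finset ℕ) : Prop :=
  B ⊆ attributes S ∧ ∀ r ∈ S, r.attrs.Nonempty → (r.attrs ∩ B).Nonempty

/-- `β(S)`: the minimum cardinality of a node cover of `G(S)`. -/
noncomputable def coverNumber (S : Finset Rule) : ℕ :=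
  sInf {k : ℕ | ∃ B : Finset ℕ, IsNodeCover S B ∧ B.card = k}

/-- `S⁺`: the rules of `S` of the length `d(S)`. -/
def plus (S : Finset Rule) : Finset Rule := S.filter fun r => r.length = maxLen S

/-- `E_C(S)`: the consistent equation systems with attributes `a ∈ A(S)` and values from `V_S(a)`
(from `EV_S(a)` for the extended problems). -/
def eqSystems (S : Finset Rule) (ext : Bool) : Finset EqSystem :=
  (((attributes S).biUnion fun a => (values S ext a).image fun v => (a, v)).powerset).filter
    Consistent

/-- `β⁺_C(S)`: the maximum over `α ∈ E_C(S)` of `β⁺(S_α)` or, if `C ∈ {EAD, ESR}`, of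
`β⁺(I_C(S_α))`, where `β⁺(T) = β(T⁺)`. -/
noncomputable def betaPlus (C : Problem) (S : Finset Rule) : ℕ :=
  (eqSystems S C.ext).sup fun α => coverNumber (plus (C.inner (restrict S α)))

/-! ## The greedy cover and the rounds -/

/-- `GreedyCover T B`: the set `B` may be obtained from the set of rules `T` by repeatedly choosing
an arbitrary rule `r`, adding `A(r)` to `B`, and removing all rules `r'` with
`A(r) ∩ A(r') ≠ ∅`, until no rules are left. -/
inductive GreedyCover : Finset Rule → Finset ℕ → Prop
  | done : GreedyCover ∅ ∅
  | step (T : Finset Rule) (r : Rule) (B : Finset ℕ) : r ∈ T →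
      GreedyCover (T.filter fun r' => r.attrs ∩ r'.attrs = ∅) B → GreedyCover T (r.attrs ∪ B)

/-- `Rounds I S δ Q s`: after the values of the attributes from `Q` on the tuple `δ` have been
computed (`α` is the obtained equation system), the remaining rounds compute, in this order, the
values of the attributes listed in `s`. The work finishes when all rules of `I(S_α)` (there may be
none) have the empty left-hand side; otherwise, a round computes the values of all attributes of a
greedy cover of `G(I(S_α)⁺)`. -/
inductive Rounds (I : Finset Rule → Finset Rule) (S : Finset Rule) (δ : ℕ → Option ℕ) :
    Finset ℕ → List ℕ → Prop
  | finish (Q : Finset ℕ) : (∀ r ∈ I (restrict S (tupleEqs δ Q)), r.length = 0) → Rounds I S δ Q []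
  | round (Q : Finset ℕ) (b s : List ℕ) :
      ¬ (∀ r ∈ I (restrict S (tupleEqs δ Q)), r.length = 0) →
      b.Nodup → GreedyCover (plus (I (restrict S (tupleEqs δ Q)))) b.toFinset →
      Rounds I S δ (Q ∪ b.toFinset) s → Rounds I S δ Q (b ++ s)

/-- A run of the algorithm for `AR` and `EAR` on the tuple `δ`: `s` lists the attributes whose
values are computed and `τ` is the result. -/
def ARun (S : Finset Rule) (δ : ℕ → Option ℕ) (s : List ℕ) (τ : Finset Rule) : Prop :=
  Rounds (fun T => T) S δ ∅ s ∧
  τ = S.filter fun r => Consistent (r.eqs ∪ tupleEqs δ s.toFinset)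

/-- A run of the algorithm for `C ∈ {EAD, ESR}` on the tuple `δ`: `s` lists the attributes whose
values are computed and `τ` is the result. -/
def BRun (C : Problem) (S : Finset Rule) (δ : ℕ → Option ℕ) (s : List ℕ) (τ : Finset Rule) :
    Prop :=
  Rounds C.inner S δ ∅ s ∧
  τ = S.filter fun r => Consistent (r.eqs ∪ tupleEqs δ s.toFinset) ∧ r.attrs ⊆ s.toFinset

/-- The tuple `δ` with each value not in `EV_{S'}(a)` replaced by `*`. -/
def adapt (S' : Finset Rule) (δ : ℕ → Option ℕ) : ℕ → Option ℕ := fun a =>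
  if δ a ∈ values S' true a then δ a else none

/-! ## Programs and their running time

The model is the textbook WHILE language over binary trees (Lisp lists): a store of finitely many
used variables holding trees, the operations `nil`, `cons`, `hd`, `tl` of cost `1`, and a test for
equality of trees whose cost is the total size of the compared trees. -/

inductive Data : Type
  | nil : Data
  | cons (l r : Data) : Data
  deriving DecidableEq

namespace Data

/-- The number of nodes of the tree. -/
def size : Data → ℕ
  | nil => 1
  | cons l r => l.size + r.size + 1

def hd : Data → Data
  | nil => nil
  | cons l _ => l

def tl : Data → Data
  | nil => nil
  | cons _ r => r

def ofBool : Bool → Data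
  | false => nil
  | true => cons nil nil

end Data

abbrev Store := ℕ → Data

inductive Expr : Type
  | var (x : ℕ) : Expr
  | nil : Expr
  | cons (e f : Expr) : Expr
  | hd (e : Expr) : Expr
  | tl (e : Expr) : Expr
  | eq (e f : Expr) : Expr

def Expr.eval (s : Store) : Expr → Data
  | var x => s x
  | nil => .nil
  | cons e f => .cons (e.eval s) (f.eval s)
  | hd e => (e.eval s).hd
  | tl e => (e.eval s).tl
  | eq e f => Data.ofBool (decide (e.eval s = f.eval s))

/-- The cost of evaluating an expression. -/
def Expr.cost (s : Store) : Expr → ℕ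
  | var _ => 1
  | nil => 1
  | cons e f => e.cost s + f.cost s + 1
  | hd e => e.cost s + 1
  | tl e => e.cost s + 1
  | eq e f => e.cost s + f.cost s + (e.eval s).size + (f.eval s).size + 1

inductive Program : Type
  | skip : Program
  | assign (x : ℕ) (e : Expr) : Program
  | seq (p q : Program) : Program
  | cond (e : Expr) (p q : Program) : Program
  | loop (e : Expr) (p : Program) : Program

/-- `Exec p s t s'`: the program `p`, started in the store `s`, halts after time `t` in the store
`s'`. The tree `nil` stands for false, every other tree for true; `loop e p` is
`while e do p`. -/
inductive Exec : Program → Store → ℕ → Store → Prop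
  | skip (s : Store) : Exec .skip s 1 s
  | assign (x : ℕ) (e : Expr) (s : Store) :
      Exec (.assign x e) s (e.cost s + 1) (Function.update s x (e.eval s))
  | seq (p q : Program) (s s' s'' : Store) (t t' : ℕ) :
      Exec p s t s' → Exec q s' t' s'' → Exec (.seq p q) s (t + t' + 1) s''
  | condTrue (e : Expr) (p q : Program) (s s' : Store) (t : ℕ) : e.eval s ≠ .nil →
      Exec p s t s' → Exec (.cond e p q) s (e.cost s + t + 1) s'
  | condFalse (e : Expr) (p q : Program) (s s' : Store) (t : ℕ) : e.eval s = .nil →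
      Exec q s t s' → Exec (.cond e p q) s (e.cost s + t + 1) s'
  | loopTrue (e : Expr) (p : Program) (s s' s'' : Store) (t t' : ℕ) : e.eval s ≠ .nil →
      Exec p s t s' → Exec (.loop e p) s' t' s'' →
      Exec (.loop e p) s (e.cost s + t + t' + 1) s''
  | loopFalse (e : Expr) (p : Program) (s : Store) : e.eval s = .nil →
      Exec (.loop e p) s (e.cost s + 1) s

/-- Started with the input `x` in variable `0` (and `nil` in all others), the program halts with
the output `y` in variable `0`, in time at most `T`. -/
def Program.ComputesIn (p : Program) (x y : Data) (T : ℕ) : Prop :=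
  ∃ (t : ℕ) (s' : Store),
    t ≤ T ∧ Exec p (Function.update (fun _ => Data.nil) 0 x) t s' ∧ s' 0 = y

/-! ## Encoding of inputs and outputs: numbers are written in binary -/

def encList {α : Type} (f : α → Data) : List α → Data
  | [] => .nil
  | x :: l => .cons (f x) (encList f l)

def encNat (n : ℕ) : Data := encList Data.ofBool n.bits

/-- A value from `ω ∪ {*}`. -/
def encValue : Option ℕ → Data
  | none => .nil
  | some n => .cons .nil (encNat n)

/-- A written rule: a list of equations and a right-hand side. -/
def encRule (r : List (ℕ × ℕ) × ℕ) : Data :=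
  .cons (encList (fun e => .cons (encNat e.1) (encNat e.2)) r.1) (encNat r.2)

def encRules (w : List (List (ℕ × ℕ) × ℕ)) : Data := encList encRule w

def encEqs (l : List (ℕ × Option ℕ)) : Data :=
  encList (fun e => .cons (encNat e.1) (encValue e.2)) l

/-- The list `w` of written rules lists the rules of `S`, each of them once, with the equations of
each left-hand side listed once; the orders are arbitrary. -/
def Presents (w : List (List (ℕ × ℕ) × ℕ)) (S : Finset Rule) : Prop :=
  (∀ p ∈ w, p.1.Nodup) ∧ (w.map fun p => (p.1.toFinset, p.2)).Nodup ∧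
  (w.map fun p => (p.1.toFinset, p.2)).toFinset = S.image fun r => (r.lhs, r.rhs)

/-- The list of the equations `a = δ a`, `a ∈ A(S)`, in the increasing order of attributes. -/
def tupleList (S : Finset Rule) (δ : ℕ → Option ℕ) : List (ℕ × Option ℕ) :=
  ((attributes S).sort (· ≤ ·)).map fun a => (a, δ a)

/-- The input: the (written) system `S` and the tuple `δ`. -/
def encInput (w : List (List (ℕ × ℕ) × ℕ)) (S : Finset Rule) (δ : ℕ → Option ℕ) : Data :=
  .cons (encRules w) (encEqs (tupleList S δ))

/-- The program `p` describes, in time bounded by `q` of the size of the input, the work of the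
tree `Γ` on each tuple from `V(S)` (from `EV(S)` for e-trees): it outputs the complete path of `Γ`
for this tuple (the list of attributes computed by `Γ` with their values) together with the set of
rules attached to the terminal node. The attributes `s` on this path and that set `τ` form a run on
`δ` in the sense of the relation `run`. -/
def Describes (p : Program) (q : Polynomial ℕ) (w : List (List (ℕ × ℕ) × ℕ)) {S : Finset Rule}
    {ext : Bool} (Γ : DTree S ext)
    (run : (ℕ → Option ℕ) → List ℕ → Finset Rule → Prop) : Prop :=
  ∀ δ : ℕ → Option ℕ, IsTuple S ext δ →
    ∃ (s : List ℕ) (τ : Finset Rule) (out : List (List (ℕ × ℕ) × ℕ)),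
      Γ.IsPath (s.map fun a => (a, δ a)) τ ∧ run δ s τ ∧ Presents out τ ∧
      p.ComputesIn (encInput w S δ)
        (.cons (encEqs (s.map fun a => (a, δ a))) (encRules out))
        (q.eval (encInput w S δ).size)

end DecisionRules

open DecisionRules

namespace DecisionRules

/-! ## Polynomial-time functions between encoded types -/

/-! Upper bound on the depth. A round computes a node cover of the longest rules of `I_C(S_α)`, so
each of these rules loses an equation or drops out, and the maximum length falls strictly
(`maxLen_inner_lt`). Hence there are at most `d` rounds, `d` being the initial maximum length. A
greedy cover is a union of disjoint sets `A(r)` with at most `d` elements, and every node cover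
meets each of them, so a round costs at most `d β⁺` (`GreedyCover.card_le`). Together this gives `d²
β⁺` (`depth_roundsTree`).

Lower bound. Let `S'` be `S` or, for `EAD` and `ESR`, the reduced system. In any tree solving
`C(S)`, a path for a tuple that realizes a longest rule of `S'` must query all attributes of that
rule (`maxLen_le_depth`). The attributes on a path for a tuple extending `α` form a node cover of
`I_C(S'_α)⁺` (`betaPlus_le_depth`). For the extended problems the tuples take the value `*` wherever
nothing is prescribed, so that no further rule can be realized. Thus `d` and `β⁺` are both at most
`h_C(S)`, and `d² β⁺ ≤ h_C(S)³`.

The problems are treated together through the relation `Problem.Covers`: a terminal label is correct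
iff its rules are realized and every rule still possible is covered by one of them. The operator
`I_C` discards exactly those unfinished rules that a realized rule covers
(`Problem.remove_mem_inner`).

The algorithms are functions on lists of written rules, and the choice of the greedy cover depends
only on the equations computed so far. Unfolding these choices yields one tree for all tuples
(`exists_tree`). Running times come from closure properties of `PolyTime`, above all from folds
whose intermediate values have polynomial size. -/

theorem polynomial_eval_mono (q : Polynomial ℕ) {m n : ℕ} (h : m ≤ n) : q.eval m ≤ q.eval n := by
  simp only [Polynomial.eval_eq_sum, Polynomial.sum]
  gcongr

/-- A type whose elements are encoded by binary trees. -/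
class Coded (α : Type) where
  enc : α → Data
  enc_injective : Function.Injective enc

open DecisionRules.Coded (enc enc_injective)

theorem encList_injective {α : Type} {f : α → Data} (hf : Function.Injective f) :
    Function.Injective (encList f) := by
  intro l
  induction l with
  | nil => intro l' h; cases l' with
    | nil => rfl
    | cons => simp [encList] at h
  | cons a l ih => intro l' h; cases l' with
    | nil => simp [encList] at h
    | cons b l' =>
      simp only [encList, Data.cons.injEq] at h
      rw [hf h.1, ih h.2]

theorem ofBool_injective : Function.Injective Data.ofBool := by
  intro a b h
  cases a <;> cases b <;> simp_all [Data.ofBool]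

theorem encNat_injective : Function.Injective encNat := by
  intro m n h
  have h : m.bits = n.bits := encList_injective ofBool_injective h
  rw [← Nat.digits_inj_iff (b := 2), Nat.digits_two_eq_bits, Nat.digits_two_eq_bits, h]

instance : Coded Bool := ⟨Data.ofBool, ofBool_injective⟩

instance : Coded ℕ := ⟨encNat, encNat_injective⟩

instance {α β : Type} [Coded α] [Coded β] : Coded (α × β) where
  enc p := .cons (enc p.1) (enc p.2)
  enc_injective := by
    rintro ⟨a, b⟩ ⟨a', b'⟩ h
    simp only [Data.cons.injEq] at h
    rw [enc_injective h.1, enc_injective h.2]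

instance {α : Type} [Coded α] : Coded (List α) := ⟨encList enc, encList_injective enc_injective⟩

instance : Coded (Option ℕ) where
  enc := encValue
  enc_injective := by
    intro a b h
    cases a <;> cases b <;> simp [encValue] at h ⊢
    exact encNat_injective h

/-- The size of the encoding. -/
def csize {α : Type} [Coded α] (a : α) : ℕ := (enc a).size

/-! ### Sizes of encodings. -/

section size

variable {α β : Type} [Coded α] [Coded β]

theorem csize_pair (p : α × β) : csize p = csize p.1 + csize p.2 + 1 := rfl

theorem csize_nil : csize ([] : List α) = 1 := rfl

theorem csize_cons (a : α) (l : List α) : csize (a :: l) = csize a + csize l + 1 := rfl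

theorem csize_append (l l' : List α) : csize (l ++ l') + 1 = csize l + csize l' := by
  induction l with
  | nil => simp [csize_nil]; omega
  | cons a l ih => simp only [List.cons_append, csize_cons]; omega

theorem csize_bool (b : Bool) : csize b ≤ 3 := by
  cases b <;> simp [csize, enc, Data.ofBool, Data.size]

theorem csize_reverse (l : List α) : csize l.reverse = csize l := by
  induction l with
  | nil => rfl
  | cons a l ih =>
    have h1 := csize_append l.reverse [a]
    simp only [List.reverse_cons, csize_cons, csize_nil] at *
    omega

theorem csize_le_of_sublist {l l' : List α} (h : l.Sublist l') : csize l ≤ csize l' := by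
  induction h with
  | slnil => exact le_rfl
  | cons a _ ih => rw [csize_cons]; omega
  | cons_cons a _ ih => rw [csize_cons, csize_cons]; omega

theorem csize_le_of_mem {a : α} {l : List α} (h : a ∈ l) : csize a ≤ csize l := by
  have := csize_le_of_sublist (List.singleton_sublist.2 h)
  rw [csize_cons] at this
  omega

theorem length_le_csize (l : List α) : l.length ≤ csize l := by
  induction l with
  | nil => simp
  | cons a l ih => rw [List.length_cons, csize_cons]; omega

theorem csize_le_of_forall_mem {l : List α} {B : ℕ} (h : ∀ a ∈ l, csize a ≤ B) :
    csize l ≤ l.length * (B + 1) + 1 := by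
  induction l with
  | nil => simp [csize_nil]
  | cons a l ih =>
    have h1 := ih fun b hb => h b (by simp [hb])
    have h2 := h a (by simp)
    rw [csize_cons, List.length_cons, Nat.add_mul]
    omega

theorem csize_flatten (L : List (List α)) : csize L.flatten ≤ csize L := by
  induction L with
  | nil => rfl
  | cons l L ih =>
    have := csize_append l L.flatten
    rw [List.flatten_cons, csize_cons]
    omega

end size

/-- The function `f` is computed on the encodings of its arguments by a program that takes its
input from the variable `0` and leaves its output there, changes only finitely many variables,
whatever they hold at the beginning, and whose time and output size are polynomially bounded. -/
def PolyTime {α β : Type} [Coded α] [Coded β] (f : α → β) : Prop :=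
  ∃ (p : Program) (n : ℕ) (q : Polynomial ℕ), ∀ (a : α) (s : Store), s 0 = enc a →
    ∃ (t : ℕ) (s' : Store), Exec p s t s' ∧ t ≤ q.eval (csize a) ∧ s' 0 = enc (f a) ∧
      csize (f a) ≤ q.eval (csize a) ∧ ∀ i, n ≤ i → s' i = s i

/-! ### Closure of polynomial time under composition, pairing and branching. -/

namespace PolyTime

section basic

variable {α β γ : Type} [Coded α] [Coded β] [Coded γ]

theorem computesIn {f : α → β} (hf : PolyTime f) : ∃ (p : Program) (q : Polynomial ℕ),
    ∀ a, p.ComputesIn (enc a) (enc (f a)) (q.eval (enc a).size) := by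
  obtain ⟨p, n, q, h⟩ := hf
  refine ⟨p, q, fun a => ?_⟩
  obtain ⟨t, s', h1, h2, h3, -, -⟩ := h a (Function.update (fun _ => Data.nil) 0 (enc a)) (by simp)
  exact ⟨t, s', h2, h1, h3⟩

theorem exists_csize_le {f : α → β} (hf : PolyTime f) :
    ∃ q : Polynomial ℕ, ∀ a, csize (f a) ≤ q.eval (csize a) := by
  obtain ⟨p, n, q, h⟩ := hf
  refine ⟨q, fun a => ?_⟩
  obtain ⟨t, s', -, -, -, h4, -⟩ := h a (fun _ => enc a) rfl
  exact h4

theorem congr {f g : α → β} (hf : PolyTime f) (h : ∀ a, f a = g a) : PolyTime g :=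
  (funext h : f = g) ▸ hf

theorem of_expr {f : α → β} (e : Expr) (q : Polynomial ℕ)
    (h : ∀ (a : α) (s : Store), s 0 = enc a → e.eval s = enc (f a) ∧ e.cost s ≤ q.eval (csize a) ∧
      csize (f a) ≤ q.eval (csize a)) : PolyTime f := by
  refine ⟨.assign 0 e, 1, q + 1, fun a s hs => ?_⟩
  obtain ⟨h1, h2, h3⟩ := h a s hs
  refine ⟨_, _, .assign 0 e s, by simpa using h2, by simpa using h1, ?_, fun i hi => ?_⟩
  · simp only [Polynomial.eval_add, Polynomial.eval_one]; omega
  · rw [Function.update_of_ne (by omega)]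

protected theorem id : PolyTime fun a : α => a :=
  of_expr (.var 0) (1 + .X) fun a s hs => by
    refine ⟨hs, ?_, ?_⟩ <;> simp [Expr.cost]

theorem comp {g : β → γ} {f : α → β} (hg : PolyTime g) (hf : PolyTime f) :
    PolyTime fun a => g (f a) := by
  obtain ⟨p, n, q, hf⟩ := hf
  obtain ⟨p', n', q', hg⟩ := hg
  refine ⟨.seq p p', n + n', q + q'.comp q + 1, fun a s hs => ?_⟩
  obtain ⟨t, s1, h1, h2, h3, h4, h5⟩ := hf a s hs
  obtain ⟨t', s2, h1', h2', h3', h4', h5'⟩ := hg (f a) s1 h3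
  have := polynomial_eval_mono q' h4
  refine ⟨_, s2, .seq _ _ _ _ _ _ _ h1 h1', ?_, h3', ?_, fun i hi => ?_⟩
  · simp only [Polynomial.eval_add, Polynomial.eval_comp, Polynomial.eval_one]; omega
  · simp only [Polynomial.eval_add, Polynomial.eval_comp, Polynomial.eval_one]; omega
  · rw [h5' i (by omega), h5 i (by omega)]

theorem fst {f : α → β × γ} (hf : PolyTime f) : PolyTime fun a => (f a).1 :=
  comp (g := fun p : β × γ => p.1) (of_expr (.hd (.var 0)) (2 + .X) fun a s hs => by
    refine ⟨by simp [Expr.eval, hs, enc, Data.hd], ?_, ?_⟩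
    · simp [Expr.cost]
    · rw [csize_pair]; simp; omega) hf

theorem snd {f : α → β × γ} (hf : PolyTime f) : PolyTime fun a => (f a).2 :=
  comp (g := fun p : β × γ => p.2) (of_expr (.tl (.var 0)) (2 + .X) fun a s hs => by
    refine ⟨by simp [Expr.eval, hs, enc, Data.tl], ?_, ?_⟩
    · simp [Expr.cost]
    · rw [csize_pair]; simp; omega) hf

/-- The expression with the constant value `d`. -/
def _root_.DecisionRules.Expr.ofData : Data → Expr
  | .nil => .nil
  | .cons l r => .cons (ofData l) (ofData r)

theorem _root_.DecisionRules.Expr.eval_ofData (d : Data) (s : Store) :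
    (Expr.ofData d).eval s = d := by
  induction d with
  | nil => rfl
  | cons l r h1 h2 => simp [Expr.ofData, Expr.eval, h1, h2]

theorem _root_.DecisionRules.Expr.cost_ofData (d : Data) (s : Store) :
    (Expr.ofData d).cost s = d.size := by
  induction d with
  | nil => rfl
  | cons l r h1 h2 => simp [Expr.ofData, Expr.cost, Data.size, h1, h2]

protected theorem const (b : β) : PolyTime fun _ : α => b :=
  of_expr (.ofData (enc b)) (.C (csize b)) fun a s hs => by
    simp [Expr.eval_ofData, Expr.cost_ofData, csize]

theorem pair {f : α → β} {g : α → γ} (hf : PolyTime f) (hg : PolyTime g) :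
    PolyTime fun a => (f a, g a) := by
  obtain ⟨p, n, q, hf⟩ := hf
  obtain ⟨p', n', q', hg⟩ := hg
  -- The variable `N` lies beyond those that either program changes, so it keeps the input while the
  -- first program runs, and `N + 1` keeps the first result during the second run.
  set N := n + n' + 1 with hN
  refine ⟨.seq (.assign N (.var 0)) (.seq p (.seq (.assign (N + 1) (.var 0))
    (.seq (.assign 0 (.var N)) (.seq p' (.assign 0 (.cons (.var (N + 1)) (.var 0))))))), N + 2,
    q + q' + 20, fun a s hs => ?_⟩
  obtain ⟨t, s1, h1, h2, h3, h4, h5⟩ := hf a (Function.update s N (s 0))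
    (by rw [Function.update_of_ne (by omega), hs])
  have hs1 : s1 N = enc a := by rw [h5 N (by omega), Function.update_self, hs]
  obtain ⟨t', s2, h1', h2', h3', h4', h5'⟩ := hg a
    (Function.update (Function.update s1 (N + 1) (s1 0)) 0 (s1 N)) (by simp [hs1])
  have e4 := Exec.assign 0 (.var N) (Function.update s1 (N + 1) (s1 0))
  simp only [Expr.eval,
    Function.update_of_ne (show N ≠ N + 1 by omega)] at e4
  refine ⟨_, _, .seq _ _ _ _ _ _ _ (.assign N (.var 0) s) (.seq _ _ _ _ _ _ _ h1
    (.seq _ _ _ _ _ _ _ (.assign (N + 1) (.var 0) s1) (.seq _ _ _ _ _ _ _ e4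
    (.seq _ _ _ _ _ _ _ h1' (.assign 0 _ s2))))), ?_, ?_, ?_, fun i hi => ?_⟩
  · simp only [Expr.cost, Polynomial.eval_add, Polynomial.eval_ofNat]; omega
  · simp only [Expr.eval, Function.update_self, h3', h5' (N + 1) (by omega)]
    rw [Function.update_of_ne (by omega), Function.update_self, h3]
    rfl
  · simp only [csize_pair, Polynomial.eval_add, Polynomial.eval_ofNat]; omega
  · rw [Function.update_of_ne (by omega), h5' i (by omega), Function.update_of_ne (by omega),
      Function.update_of_ne (by omega), h5 i (by omega), Function.update_of_ne (by omega)]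

theorem cond {c : α → Bool} {f g : α → β} (hc : PolyTime c) (hf : PolyTime f) (hg : PolyTime g) :
    PolyTime fun a => bif c a then f a else g a := by
  obtain ⟨pc, nc, qc, hc⟩ := hc
  obtain ⟨p, n, q, hf⟩ := hf
  obtain ⟨p', n', q', hg⟩ := hg
  set N := nc + n + n' + 1 with hN
  refine ⟨.seq (.assign N (.var 0)) (.seq pc (.cond (.var 0) (.seq (.assign 0 (.var N)) p)
    (.seq (.assign 0 (.var N)) p'))), N + 1, qc + q + q' + 20, fun a s hs => ?_⟩
  obtain ⟨t, s1, h1, h2, h3, h4, h5⟩ := hc a (Function.update s N (s 0))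
    (by rw [Function.update_of_ne (by omega), hs])
  have hs1 : s1 N = enc a := by rw [h5 N (by omega), Function.update_self, hs]
  have e1 := Exec.assign 0 (.var N) s1
  simp only [Expr.eval] at e1
  cases hca : c a
  · obtain ⟨t', s2, h1', h2', h3', h4', h5'⟩ := hg a (Function.update s1 0 (s1 N)) (by simp [hs1])
    refine ⟨_, _, .seq _ _ _ _ _ _ _ (.assign N (.var 0) s) (.seq _ _ _ _ _ _ _ h1
      (.condFalse _ _ _ _ _ _ ?_ (.seq _ _ _ _ _ _ _ e1 h1'))), ?_, by simpa [hca] using h3', ?_,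
      fun i hi => ?_⟩
    · rw [Expr.eval, h3, hca]; rfl
    · simp only [Expr.cost, Polynomial.eval_add, Polynomial.eval_ofNat]; omega
    · simp only [hca, cond_false, Polynomial.eval_add, Polynomial.eval_ofNat]; omega
    · rw [h5' i (by omega), Function.update_of_ne (by omega), h5 i (by omega),
        Function.update_of_ne (by omega)]
  · obtain ⟨t', s2, h1', h2', h3', h4', h5'⟩ := hf a (Function.update s1 0 (s1 N)) (by simp [hs1])
    refine ⟨_, _, .seq _ _ _ _ _ _ _ (.assign N (.var 0) s) (.seq _ _ _ _ _ _ _ h1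
      (.condTrue _ _ _ _ _ _ ?_ (.seq _ _ _ _ _ _ _ e1 h1'))), ?_, by simpa [hca] using h3', ?_,
      fun i hi => ?_⟩
    · rw [Expr.eval, h3, hca]; simp [enc, Data.ofBool]
    · simp only [Expr.cost, Polynomial.eval_add, Polynomial.eval_ofNat]; omega
    · simp only [hca, cond_true, Polynomial.eval_add, Polynomial.eval_ofNat]; omega
    · rw [h5' i (by omega), Function.update_of_ne (by omega), h5 i (by omega),
        Function.update_of_ne (by omega)]

theorem beq [DecidableEq β] {f g : α → β} (hf : PolyTime f) (hg : PolyTime g) :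
    PolyTime fun a => decide (f a = g a) :=
  comp (g := fun p : β × β => decide (p.1 = p.2))
    (of_expr (.eq (.hd (.var 0)) (.tl (.var 0))) (.X + 5) fun a s hs => by
      refine ⟨?_, ?_, ?_⟩
      · simp only [Expr.eval, hs]
        simp only [enc, Data.hd, Data.tl, enc_injective.eq_iff]
      · simp only [Expr.cost, Expr.eval, hs, Polynomial.eval_add, Polynomial.eval_ofNat,
          Polynomial.eval_X, csize_pair]
        simp only [enc, Data.hd, Data.tl, csize]; omega
      · have := csize_bool (decide (a.1 = a.2))
        simp only [Polynomial.eval_add, Polynomial.eval_ofNat]; omega) (hf.pair hg)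

theorem not {c : α → Bool} (hc : PolyTime c) : PolyTime fun a => !c a :=
  (hc.cond (.const false) (.const true)).congr fun a => by cases c a <;> rfl

end basic

end PolyTime

/-! ### Folds and the list operations derived from them. -/

namespace PolyTime

section lists

variable {α β γ : Type} [Coded α] [Coded β] [Coded γ]

/-- The body of the loop that folds a list: the variable `N` holds the context, `N + 1` the rest of
the list, and `N + 2` the accumulated value. -/
def foldBody (p : Program) (N : ℕ) : Program :=
  .seq (.assign 0 (.cons (.var N) (.cons (.var (N + 2)) (.hd (.var (N + 1)))))) (.seq p
    (.seq (.assign (N + 2) (.var 0)) (.assign (N + 1) (.tl (.var (N + 1))))))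

theorem exec_foldBody {f : γ × β × α → β} {p : Program} {n N : ℕ} {q : Polynomial ℕ}
    (hf : ∀ (a : γ × β × α) (s : Store), s 0 = enc a →
      ∃ (t : ℕ) (s' : Store), Exec p s t s' ∧ t ≤ q.eval (csize a) ∧ s' 0 = enc (f a) ∧
        csize (f a) ≤ q.eval (csize a) ∧ ∀ i, n ≤ i → s' i = s i) (hn : n < N)
    (c : γ) (b : β) (a : α) (l : List α) (s : Store) (h0 : s N = enc c)
    (h1 : s (N + 1) = enc (a :: l)) (h2 : s (N + 2) = enc b) :
    ∃ (t : ℕ) (s' : Store), Exec (foldBody p N) s t s' ∧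
      t ≤ q.eval (csize c + csize b + csize a + 2) + 20 ∧
      s' N = enc c ∧ s' (N + 1) = enc l ∧ s' (N + 2) = enc (f (c, b, a)) ∧
      ∀ i, N + 3 ≤ i → s' i = s i := by
  set s1 := Function.update s 0 (enc (c, b, a)) with hs1
  obtain ⟨t, s2, e2, ht, hs2, -, hfr⟩ := hf (c, b, a) s1 (by simp [hs1])
  have e1 := Exec.assign 0 (.cons (.var N) (.cons (.var (N + 2)) (.hd (.var (N + 1))))) s
  have he : Expr.eval s (.cons (.var N) (.cons (.var (N + 2)) (.hd (.var (N + 1))))) =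
      enc (c, b, a) := by
    simp only [Expr.eval, h0, h1, h2]; rfl
  rw [he, ← hs1] at e1
  have hfr' : ∀ i, N ≤ i → s2 i = s i := fun i hi => by
    rw [hfr i (by omega), hs1, Function.update_of_ne (by omega)]
  refine ⟨_, _, .seq _ _ _ _ _ _ _ e1 (.seq _ _ _ _ _ _ _ e2 (.seq _ _ _ _ _ _ _
    (.assign _ _ _) (.assign _ _ _))), ?_, ?_, ?_, ?_, fun i hi => ?_⟩
  · have : csize (c, b, a) = csize c + csize b + csize a + 2 := by
      simp only [csize_pair]; omega
    rw [this] at ht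
    simp only [Expr.cost]; omega
  · rw [Function.update_of_ne (by omega), Function.update_of_ne (by omega), hfr' _ le_rfl, h0]
  · simp only [Function.update_self, Expr.eval]
    rw [Function.update_of_ne (by omega),
      hfr' _ (by omega), h1]
    rfl
  · rw [Function.update_of_ne (by omega), Function.update_self, Expr.eval, hs2]
  · rw [Function.update_of_ne (by omega), Function.update_of_ne (by omega), hfr' _ (by omega)]

/-- `M` bounds the accumulated value after every prefix and `L` the list, so each pass has the same
time bound and the total is the number of passes times it. -/
theorem exec_fold {f : γ × β × α → β} {p : Program} {n N : ℕ} {q : Polynomial ℕ}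
    (hf : ∀ (a : γ × β × α) (s : Store), s 0 = enc a →
      ∃ (t : ℕ) (s' : Store), Exec p s t s' ∧ t ≤ q.eval (csize a) ∧ s' 0 = enc (f a) ∧
        csize (f a) ≤ q.eval (csize a) ∧ ∀ i, n ≤ i → s' i = s i) (hn : n < N)
    (c : γ) (L M : ℕ) (l : List α) : ∀ (b : β) (s : Store), s N = enc c →
      s (N + 1) = enc l → s (N + 2) = enc b → csize l ≤ L →
      (∀ l', l' <+: l → csize (l'.foldl (fun b a => f (c, b, a)) b) ≤ M) →
      ∃ (t : ℕ) (s' : Store), Exec (.loop (.var (N + 1)) (foldBody p N)) s t s' ∧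
        t ≤ l.length * (q.eval (csize c + M + L + 2) + 22) + 2 ∧
        s' (N + 2) = enc (l.foldl (fun b a => f (c, b, a)) b) ∧ ∀ i, N + 3 ≤ i → s' i = s i := by
  induction l with
  | nil =>
    intro b s h0 h1 h2 _ _
    exact ⟨_, s, .loopFalse _ _ _ h1, by simp [Expr.cost], h2, fun _ _ => rfl⟩
  | cons a l ih =>
    intro b s h0 h1 h2 hL hM
    obtain ⟨t, s1, e1, ht, k0, k1, k2, k3⟩ := exec_foldBody hf hn c b a l s h0 h1 h2
    have hb : csize b ≤ M := hM [] (List.nil_prefix)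
    rw [csize_cons] at hL
    obtain ⟨t', s2, e2, ht', k2', k3'⟩ := ih (f (c, b, a)) s1 k0 k1 k2 (by omega) fun l' hl' => by
      simpa using hM (a :: l') (by simpa using hl')
    refine ⟨_, s2, .loopTrue _ _ _ _ _ _ _ ?_ e1 e2, ?_, k2', fun i hi => ?_⟩
    · simp only [Expr.eval, h1]; simp [enc, encList]
    · have := polynomial_eval_mono q
        (show csize c + csize b + csize a + 2 ≤ csize c + M + L + 2 by omega)
      rw [List.length_cons, Nat.succ_mul]
      simp only [Expr.cost]
      omega
    · rw [k3' i hi, k3 i hi]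

/-- The bound over all prefixes cannot be dropped: iterating a polynomial-time step may double the
accumulated value each time. With it, a polynomial number of passes has polynomial cost each. -/
theorem foldl {l : γ → List α} {init : γ → β} {f : γ × β × α → β} (hl : PolyTime l)
    (hinit : PolyTime init) (hf : PolyTime f)
    (hB : ∃ Q : Polynomial ℕ, ∀ c l', l' <+: l c →
      csize (l'.foldl (fun b a => f (c, b, a)) (init c)) ≤ Q.eval (csize c)) :
    PolyTime fun c => (l c).foldl (fun b a => f (c, b, a)) (init c) := by
  obtain ⟨Q, hB⟩ := hB
  obtain ⟨p1, n1, q1, hl⟩ := hl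
  obtain ⟨p2, n2, q2, hinit⟩ := hinit
  obtain ⟨p, n, q, hf⟩ := hf
  set N := n1 + n2 + n + 1 with hN
  -- In the time bound, `q1` bounds the number of passes as well as the size of the list. The body
  -- receives the context, an accumulated value bounded by `Q`, and a list element, which explains
  -- the argument of `q`.
  refine ⟨.seq (.assign N (.var 0)) (.seq p1 (.seq (.assign (N + 1) (.var 0)) (.seq
    (.assign 0 (.var N)) (.seq p2 (.seq (.assign (N + 2) (.var 0)) (.seq
    (.loop (.var (N + 1)) (foldBody p N)) (.assign 0 (.var (N + 2))))))))), N + 3,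
    Q + q1 + q2 + q1 * (q.comp (.X + Q + q1 + 2) + 22) + 30, fun c s hs => ?_⟩
  obtain ⟨t, s1, h1, h2, h3, h4, h5⟩ := hl c (Function.update s N (s 0))
    (by rw [Function.update_of_ne (by omega), hs])
  have hs1 : s1 N = enc c := by rw [h5 N (by omega), Function.update_self, hs]
  have e4 := Exec.assign 0 (.var N) (Function.update s1 (N + 1) (s1 0))
  simp only [Expr.eval, Function.update_of_ne (show N ≠ N + 1 by omega)] at e4
  obtain ⟨t', s2, h1', h2', h3', h4', h5'⟩ := hinit c
    (Function.update (Function.update s1 (N + 1) (s1 0)) 0 (s1 N)) (by simp [hs1])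
  have k0 : s2 N = enc c := by
    rw [h5' N (by omega), Function.update_of_ne (by omega), Function.update_of_ne (by omega), hs1]
  have k1 : s2 (N + 1) = enc (l c) := by
    rw [h5' _ (by omega), Function.update_of_ne (by omega), Function.update_self, h3]
  obtain ⟨t'', s3, g1, g2, g3, g4⟩ := exec_fold hf (show n < N by omega) c _ _ (l c) (init c)
    (Function.update s2 (N + 2) (s2 0)) (by rw [Function.update_of_ne (by omega), k0])
    (by rw [Function.update_of_ne (by omega), k1]) (by rw [Function.update_self, h3']) h4 (hB c)
  refine ⟨_, _, .seq _ _ _ _ _ _ _ (.assign N (.var 0) s) (.seq _ _ _ _ _ _ _ h1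
    (.seq _ _ _ _ _ _ _ (.assign (N + 1) (.var 0) s1) (.seq _ _ _ _ _ _ _ e4
    (.seq _ _ _ _ _ _ _ h1' (.seq _ _ _ _ _ _ _ (.assign (N + 2) (.var 0) s2)
    (.seq _ _ _ _ _ _ _ g1 (.assign 0 _ s3))))))), ?_, ?_, ?_, fun i hi => ?_⟩
  · have := Nat.mul_le_mul_right (Polynomial.eval (csize c + Polynomial.eval (csize c) Q +
      Polynomial.eval (csize c) q1 + 2) q + 22) ((length_le_csize (l c)).trans h4)
    simp only [Expr.cost, Polynomial.eval_add, Polynomial.eval_ofNat, Polynomial.eval_mul,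
      Polynomial.eval_comp, Polynomial.eval_X]
    omega
  · simp only [Expr.eval, Function.update_self, g3]
  · have := hB c (l c) (List.prefix_refl _)
    simp only [Polynomial.eval_add]; omega
  · rw [Function.update_of_ne (by omega), g4 i hi, Function.update_of_ne (by omega),
      h5' i (by omega), Function.update_of_ne (by omega), Function.update_of_ne (by omega),
      h5 i (by omega), Function.update_of_ne (by omega)]

theorem cons {f : γ → α} {l : γ → List α} (hf : PolyTime f) (hl : PolyTime l) :
    PolyTime fun c => f c :: l c :=
  comp (g := fun p : α × List α => p.1 :: p.2) (of_expr (.var 0) (.X + 1) fun a s hs => by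
    refine ⟨hs, ?_, ?_⟩
    · simp [Expr.cost]
    · rw [csize_cons, csize_pair]; simp) (hf.pair hl)

theorem some {f : γ → ℕ} (hf : PolyTime f) : PolyTime fun c => some (f c) :=
  comp (g := fun n : ℕ => Option.some n) (of_expr (.cons .nil (.var 0)) (.X + 3) fun a s hs => by
    refine ⟨?_, ?_, ?_⟩
    · simp only [Expr.eval, hs]; rfl
    · simp [Expr.cost]
    · simp only [csize, enc, encValue, Data.size, Polynomial.eval_add, Polynomial.eval_X,
        Polynomial.eval_ofNat]
      omega) hf

theorem tail {l : γ → List α} (hl : PolyTime l) : PolyTime fun c => (l c).tail :=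
  comp (g := fun l : List α => l.tail) (of_expr (.tl (.var 0)) (.X + 2) fun a s hs => by
    refine ⟨?_, ?_, ?_⟩
    · simp only [Expr.eval, hs]; cases a <;> rfl
    · simp [Expr.cost]
    · cases a
      · simp [csize_nil]
      · simp only [List.tail_cons, csize_cons, Polynomial.eval_add, Polynomial.eval_X,
          Polynomial.eval_ofNat]
        omega) hl

theorem isEmpty {l : γ → List α} (hl : PolyTime l) : PolyTime fun c => (l c).isEmpty := by
  classical
  exact (hl.beq (.const [])).congr fun c => by cases l c <;> simp

theorem reverse {l : γ → List α} (hl : PolyTime l) : PolyTime fun c => (l c).reverse := by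
  obtain ⟨q, hq⟩ := hl.exists_csize_le
  have hrev : ∀ l : List α, l.foldl (fun b a => a :: b) [] = l.reverse := by simp
  refine (foldl (f := fun p : γ × List α × α => p.2.2 :: p.2.1) hl (.const [])
    (cons PolyTime.id.snd.snd PolyTime.id.snd.fst) ⟨q, fun c l' hl' => ?_⟩).congr fun c => by
      simp
  rw [hrev, csize_reverse]
  exact (csize_le_of_sublist hl'.sublist).trans (hq c)

/-- A left fold of the reversed list; its prefixes are reversed suffixes. Right folds build
`filter`, `map` and `append` in the original order. -/
theorem foldr {l : γ → List α} {init : γ → β} {f : γ × β × α → β} (hl : PolyTime l)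
    (hinit : PolyTime init) (hf : PolyTime f)
    (hB : ∃ Q : Polynomial ℕ, ∀ c l', l' <:+ l c →
      csize (l'.foldr (fun a b => f (c, b, a)) (init c)) ≤ Q.eval (csize c)) :
    PolyTime fun c => (l c).foldr (fun a b => f (c, b, a)) (init c) := by
  obtain ⟨Q, hB⟩ := hB
  refine (foldl hl.reverse hinit hf ⟨Q, fun c l' hl' => ?_⟩).congr fun c => by
    rw [List.foldl_reverse]
  have := hB c l'.reverse (by simpa using List.reverse_suffix.2 hl')
  rwa [List.foldr_reverse] at this

theorem filter {l : γ → List α} {f : γ × α → Bool} (hl : PolyTime l) (hf : PolyTime f) :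
    PolyTime fun c => (l c).filter fun a => f (c, a) := by
  obtain ⟨q, hq⟩ := hl.exists_csize_le
  have hfil : ∀ c (l : List α), l.foldr (fun a b => bif f (c, a) then a :: b else b) [] =
      l.filter fun a => f (c, a) := by
    intro c l
    induction l with
    | nil => rfl
    | cons a l ih => rw [List.foldr_cons, ih, List.filter_cons]; cases f (c, a) <;> rfl
  refine (foldr (f := fun p : γ × List α × α => bif f (p.1, p.2.2) then p.2.2 :: p.2.1 else p.2.1)
    hl (.const []) ?_ ⟨q, fun c l' hl' => ?_⟩).congr fun c => hfil c _
  · exact (hf.comp (PolyTime.id.fst.pair PolyTime.id.snd.snd)).cond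
      (cons PolyTime.id.snd.snd PolyTime.id.snd.fst) PolyTime.id.snd.fst
  · rw [hfil]
    exact (csize_le_of_sublist (List.filter_sublist.trans hl'.sublist)).trans (hq c)

theorem map {l : γ → List α} {f : γ × α → β} (hl : PolyTime l) (hf : PolyTime f) :
    PolyTime fun c => (l c).map fun a => f (c, a) := by
  obtain ⟨q, hq⟩ := hl.exists_csize_le
  obtain ⟨q', hq'⟩ := hf.exists_csize_le
  have hmap : ∀ c (l : List α), l.foldr (fun a b => f (c, a) :: b) [] =
      l.map fun a => f (c, a) := by
    intro c l
    induction l with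
    | nil => rfl
    | cons a l ih => rw [List.foldr_cons, ih, List.map_cons]
  refine (foldr (f := fun p : γ × List β × α => f (p.1, p.2.2) :: p.2.1)
    hl (.const []) ?_ ⟨q * (q'.comp (.X + q + 1) + 1) + 1, fun c l' hl' => ?_⟩).congr
      fun c => hmap c _
  · exact cons (hf.comp (PolyTime.id.fst.pair PolyTime.id.snd.snd)) PolyTime.id.snd.fst
  · rw [hmap]
    refine (csize_le_of_forall_mem (B := q'.eval (csize c + q.eval (csize c) + 1))
      fun b hb => ?_).trans ?_
    · obtain ⟨a, ha, rfl⟩ := List.mem_map.1 hb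
      refine (hq' _).trans (polynomial_eval_mono _ ?_)
      have := (csize_le_of_mem (hl'.subset ha)).trans (hq c)
      simp only [csize_pair]
      omega
    · have h1 := (csize_le_of_sublist hl'.sublist).trans (hq c)
      have h2 := (length_le_csize l').trans h1
      simp only [List.length_map, Polynomial.eval_add, Polynomial.eval_mul, Polynomial.eval_comp,
        Polynomial.eval_X, Polynomial.eval_one]
      gcongr

theorem any {l : γ → List α} {f : γ × α → Bool} (hl : PolyTime l) (hf : PolyTime f) :
    PolyTime fun c => (l c).any fun a => f (c, a) :=
  (hl.filter hf).isEmpty.not.congr fun c => by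
    rw [Bool.eq_iff_iff]; simp

theorem all {l : γ → List α} {f : γ × α → Bool} (hl : PolyTime l) (hf : PolyTime f) :
    PolyTime fun c => (l c).all fun a => f (c, a) :=
  (hl.filter hf.not).isEmpty.congr fun c => by
    rw [Bool.eq_iff_iff]; simp

theorem and {f g : γ → Bool} (hf : PolyTime f) (hg : PolyTime g) : PolyTime fun c => f c && g c :=
  (hf.cond hg (.const false)).congr fun c => by cases f c <;> rfl

theorem or {f g : γ → Bool} (hf : PolyTime f) (hg : PolyTime g) : PolyTime fun c => f c || g c :=
  (hf.cond (.const true) hg).congr fun c => by cases f c <;> rfl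

theorem append {l l' : γ → List α} (hl : PolyTime l) (hl' : PolyTime l') :
    PolyTime fun c => l c ++ l' c := by
  obtain ⟨q, hq⟩ := hl.exists_csize_le
  obtain ⟨q', hq'⟩ := hl'.exists_csize_le
  refine (foldr (f := fun p : γ × List α × α => p.2.2 :: p.2.1) hl hl'
    (cons PolyTime.id.snd.snd PolyTime.id.snd.fst) ⟨q + q', fun c k hk => ?_⟩).congr fun c => by
      simp
  have h1 := (csize_le_of_sublist hk.sublist).trans (hq c)
  have h2 := csize_append k (l' c)
  have h3 := hq' c
  rw [List.foldr_cons_eq_append', Polynomial.eval_add]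
  omega

theorem flatten {L : γ → List (List α)} (hL : PolyTime L) : PolyTime fun c => (L c).flatten := by
  obtain ⟨q, hq⟩ := hL.exists_csize_le
  have hfl : ∀ L : List (List α), L.foldr (fun a b => a ++ b) [] = L.flatten := by
    intro L
    induction L with
    | nil => rfl
    | cons a L ih => rw [List.foldr_cons, ih, List.flatten_cons]
  refine (foldr (f := fun p : γ × List α × List α => p.2.2 ++ p.2.1) hL (.const [])
    (append PolyTime.id.snd.snd PolyTime.id.snd.fst) ⟨q, fun c k hk => ?_⟩).congr fun c => hfl _
  rw [hfl]
  exact ((csize_flatten k).trans (csize_le_of_sublist hk.sublist)).trans (hq c)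

end lists

end PolyTime

/-! ## The algorithms on lists of written rules -/

/-- A written rule. -/
abbrev WRule := List (ℕ × ℕ) × ℕ

/-- An equation with a value from `ω ∪ {*}`. -/
abbrev Eqn := ℕ × Option ℕ

def consistentL (r : WRule) (α : List Eqn) : Bool :=
  r.1.all fun e => α.all fun p => !decide (p.1 = e.1) || decide (p.2 = some e.2)

def removeL (α : List Eqn) (r : WRule) : WRule :=
  (r.1.filter fun e => !α.any fun p => decide (p = (e.1, some e.2)), r.2)

def restrictL (w : List WRule) (α : List Eqn) : List WRule :=
  (w.filter fun r => consistentL r α).map fun r => removeL α r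

/-- Comparison without arithmetic: one element of `l` is dropped for each element of `l'`. -/
def lengthLE {β : Type} (l l' : List β) : Bool := (l'.foldl (fun b _ => b.tail) l).isEmpty

def plusL (w : List WRule) : List WRule := w.filter fun r => w.all fun r' => lengthLE r'.1 r.1

def disjointL (r r' : WRule) : Bool := r.1.all fun e => r'.1.all fun e' => !decide (e.1 = e'.1)

/-- The rules chosen in one pass over the list: a rule is chosen if its attributes differ from
those of the rules chosen before. -/
def greedyL (w : List WRule) : List WRule :=
  w.foldl (fun ch r => bif ch.all fun r' => disjointL r r' then r :: ch else ch) []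

/-- The attributes of the chosen rules. -/
def coverL (w : List WRule) : List ℕ :=
  ((greedyL w).map fun r => r.1.map fun e => e.1).flatten

def innerSRL (w : List WRule) : List WRule :=
  bif w.any fun r => r.1.isEmpty then w.filter fun r => r.1.isEmpty else w

def innerADL (w : List WRule) : List WRule :=
  w.filter fun r => r.1.isEmpty || w.all fun r' => !r'.1.isEmpty || !decide (r'.2 = r.2)

def subsetL (l l' : List (ℕ × ℕ)) : Bool := l.all fun e => l'.any fun e' => decide (e' = e)

def reduceSRL (w : List WRule) : List WRule :=
  w.filter fun r => w.all fun r' => !(subsetL r'.1 r.1 && !subsetL r.1 r'.1)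

def reduceADL (w : List WRule) : List WRule :=
  w.filter fun r => w.all fun r' =>
    !decide (r'.2 = r.2) || !(subsetL r'.1 r.1 && !subsetL r.1 r'.1)

/-- A value that does not occur with the attribute in the rules of `w` is replaced by `*`. -/
def adaptL (w : List WRule) (p : Eqn) : Eqn :=
  (p.1, bif w.any fun r => r.1.any fun e => decide ((e.1, some e.2) = p) then p.2 else none)

/-- The rules that the next round deals with, when the equations `ξ` have been computed. -/
def stateL (I : List WRule → List WRule) (w : List WRule) (ξ : List Eqn) : List WRule :=
  I (restrictL w (ξ.map fun p => adaptL w p))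

def doneL (I : List WRule → List WRule) (w : List WRule) (ξ : List Eqn) : Bool :=
  (stateL I w ξ).all fun r => r.1.isEmpty

/-- Whether the next round computes the value of the attribute `a`. -/
def pickL (I : List WRule → List WRule) (w : List WRule) (ξ : List Eqn) (a : ℕ) : Bool :=
  (coverL (plusL (stateL I w ξ))).any fun b => decide (b = a)

/-- Filtering the tuple list supplies the values together with the attributes and fixes their order,
which then does not depend on the order of the greedy cover. -/
def stepL (I : List WRule → List WRule) (w : List WRule) (tl ξ : List Eqn) : List Eqn :=
  bif doneL I w ξ then ξ else ξ ++ tl.filter fun p => pickL I w ξ p.1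

/-- The entries of `tl` serve only as a clock: there are at least as many of them as rounds, and
steps after the end change nothing. -/
def runL (I : List WRule → List WRule) (w : List WRule) (tl : List Eqn) : List Eqn :=
  tl.foldl (fun ξ _ => stepL I w tl ξ) []

def resultL (w : List WRule) (ξ : List Eqn) : List WRule :=
  w.filter fun r => r.1.all fun e => ξ.any fun p => decide (p = (e.1, some e.2))

/-- `R` is the identity or a reduction, `I` represents `I_C`. -/
def algL (R I : List WRule → List WRule) (x : List WRule × List Eqn) : List Eqn × List WRule :=
  (runL I (R x.1) x.2, resultL (R x.1) (runL I (R x.1) x.2))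

/-! ### The list algorithms run in polynomial time. -/

namespace PolyTime

variable {γ : Type} [Coded γ]

theorem consistentL {r : γ → WRule} {α : γ → List Eqn} (hr : PolyTime r) (hα : PolyTime α) :
    PolyTime fun c => consistentL (r c) (α c) := by
  refine (hr.fst).all (f := fun x : γ × ℕ × ℕ => (α x.1).all fun p =>
    !decide (p.1 = x.2.1) || decide (p.2 = Option.some x.2.2)) ?_
  refine (hα.comp PolyTime.id.fst).all (f := fun x : (γ × ℕ × ℕ) × Eqn =>
    !decide (x.2.1 = x.1.2.1) || decide (x.2.2 = Option.some x.1.2.2)) ?_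
  exact (PolyTime.id.snd.fst.beq PolyTime.id.fst.snd.fst).not.or
    (PolyTime.id.snd.snd.beq PolyTime.id.fst.snd.snd.some)

/-- Whether the equation belongs to the list. -/
theorem any_eqn {α : γ → List Eqn} {e : γ → ℕ × ℕ} (hα : PolyTime α) (he : PolyTime e) :
    PolyTime fun c => (α c).any fun p => decide (p = ((e c).1, Option.some (e c).2)) := by
  refine hα.any (f := fun x : γ × Eqn => decide (x.2 = ((e x.1).1, Option.some (e x.1).2))) ?_
  have := he.comp (PolyTime.id (α := γ × Eqn)).fst
  exact PolyTime.id.snd.beq (this.fst.pair this.snd.some)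

theorem removeL {r : γ → WRule} {α : γ → List Eqn} (hα : PolyTime α) (hr : PolyTime r) :
    PolyTime fun c => removeL (α c) (r c) := by
  refine pair ?_ hr.snd
  exact hr.fst.filter (f := fun x : γ × ℕ × ℕ =>
    !(α x.1).any fun p => decide (p = (x.2.1, Option.some x.2.2)))
    (any_eqn (hα.comp PolyTime.id.fst) PolyTime.id.snd).not

theorem restrictL {w : γ → List WRule} {α : γ → List Eqn} (hw : PolyTime w) (hα : PolyTime α) :
    PolyTime fun c => restrictL (w c) (α c) := by
  refine (hw.filter (f := fun x : γ × WRule => DecisionRules.consistentL x.2 (α x.1)) ?_).map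
    (f := fun x : γ × WRule => DecisionRules.removeL (α x.1) x.2) ?_
  · exact consistentL PolyTime.id.snd (hα.comp PolyTime.id.fst)
  · exact removeL (hα.comp PolyTime.id.fst) PolyTime.id.snd

theorem lengthLE {β : Type} [Coded β] {l l' : γ → List β} (hl : PolyTime l) (hl' : PolyTime l') :
    PolyTime fun c => lengthLE (l c) (l' c) := by
  obtain ⟨q, hq⟩ := hl.exists_csize_le
  have hsub : ∀ k m : List β, (k.foldl (fun b _ => b.tail) m).Sublist m := by
    intro k
    induction k with
    | nil => exact fun m => List.Sublist.refl _
    | cons a k ih => exact fun m => (ih m.tail).trans (List.tail_sublist m)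
  exact (foldl (f := fun x : γ × List β × β => x.2.1.tail) hl' hl PolyTime.id.snd.fst.tail
    ⟨q, fun c k _ => (csize_le_of_sublist (hsub k (l c))).trans (hq c)⟩).isEmpty

theorem plusL {w : γ → List WRule} (hw : PolyTime w) : PolyTime fun c => plusL (w c) := by
  refine hw.filter (f := fun x : γ × WRule =>
    (w x.1).all fun r' => DecisionRules.lengthLE r'.1 x.2.1) ?_
  refine (hw.comp PolyTime.id.fst).all (f := fun x : (γ × WRule) × WRule =>
    DecisionRules.lengthLE x.2.1 x.1.2.1) ?_
  exact lengthLE PolyTime.id.snd.fst PolyTime.id.fst.snd.fst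

theorem disjointL {r r' : γ → WRule} (hr : PolyTime r) (hr' : PolyTime r') :
    PolyTime fun c => disjointL (r c) (r' c) := by
  refine hr.fst.all (f := fun x : γ × ℕ × ℕ =>
    (r' x.1).1.all fun e' => !decide (x.2.1 = e'.1)) ?_
  exact (hr'.comp PolyTime.id.fst).fst.all (f := fun x : (γ × ℕ × ℕ) × ℕ × ℕ =>
    !decide (x.1.2.1 = x.2.1)) (PolyTime.id.fst.snd.fst.beq PolyTime.id.snd.fst).not

theorem greedyL {w : γ → List WRule} (hw : PolyTime w) : PolyTime fun c => greedyL (w c) := by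
  obtain ⟨q, hq⟩ := hw.exists_csize_le
  refine foldl (f := fun x : γ × List WRule × WRule =>
    bif x.2.1.all fun r' => DecisionRules.disjointL x.2.2 r' then x.2.2 :: x.2.1 else x.2.1) hw
    (.const []) (cond ?_ (cons PolyTime.id.snd.snd PolyTime.id.snd.fst) PolyTime.id.snd.fst)
    ⟨q, fun c k hk => ?_⟩
  · exact PolyTime.id.snd.fst.all (f := fun x : (γ × List WRule × WRule) × WRule =>
      DecisionRules.disjointL x.1.2.2 x.2) (disjointL PolyTime.id.fst.snd.snd PolyTime.id.snd)
  · have : ∀ (k m : List WRule), csize (k.foldl (fun ch r =>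
        bif ch.all fun r' => DecisionRules.disjointL r r' then r :: ch else ch) m) + 1 ≤
        csize m + csize k := by
      intro k
      induction k with
      | nil => intro m; simp [csize_nil]
      | cons r k ih =>
        intro m
        have := ih (bif m.all fun r' => DecisionRules.disjointL r r' then r :: m else m)
        rw [List.foldl_cons, csize_cons]
        cases h : m.all fun r' => DecisionRules.disjointL r r' <;>
          simp only [h, cond_true, cond_false, csize_cons] at this ⊢ <;> omega
    have h1 := this k []
    rw [csize_nil] at h1
    exact le_trans (b := csize k) (by dsimp only; omega) ((csize_le_of_sublist hk.sublist).trans (hq c))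

theorem coverL {w : γ → List WRule} (hw : PolyTime w) : PolyTime fun c => coverL (w c) := by
  refine flatten ((greedyL hw).map (f := fun x : γ × WRule => x.2.1.map fun e => e.1) ?_)
  exact PolyTime.id.snd.fst.map (f := fun x : (γ × WRule) × ℕ × ℕ => x.2.1) PolyTime.id.snd.fst

theorem innerSRL : PolyTime innerSRL := by
  have h : PolyTime fun x : List WRule × WRule => x.2.1.isEmpty := PolyTime.id.snd.fst.isEmpty
  exact cond (PolyTime.id.any h) (PolyTime.id.filter h) PolyTime.id

theorem innerADL : PolyTime innerADL := by
  refine PolyTime.id.filter (f := fun x : List WRule × WRule => x.2.1.isEmpty ||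
    x.1.all fun r' => !r'.1.isEmpty || !decide (r'.2 = x.2.2)) (PolyTime.id.snd.fst.isEmpty.or ?_)
  exact PolyTime.id.fst.all (f := fun x : (List WRule × WRule) × WRule =>
    !x.2.1.isEmpty || !decide (x.2.2 = x.1.2.2)) (PolyTime.id.snd.fst.isEmpty.not.or
      (PolyTime.id.snd.snd.beq PolyTime.id.fst.snd.snd).not)

theorem subsetL {l l' : γ → List (ℕ × ℕ)} (hl : PolyTime l) (hl' : PolyTime l') :
    PolyTime fun c => subsetL (l c) (l' c) := by
  refine hl.all (f := fun x : γ × ℕ × ℕ => (l' x.1).any fun e' => decide (e' = x.2)) ?_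
  exact (hl'.comp PolyTime.id.fst).any (f := fun x : (γ × ℕ × ℕ) × ℕ × ℕ => decide (x.2 = x.1.2))
    (PolyTime.id.snd.beq PolyTime.id.fst.snd)

theorem reduceSRL : PolyTime reduceSRL := by
  refine PolyTime.id.filter (f := fun x : List WRule × WRule => x.1.all fun r' =>
    !(DecisionRules.subsetL r'.1 x.2.1 && !DecisionRules.subsetL x.2.1 r'.1)) ?_
  exact PolyTime.id.fst.all (f := fun x : (List WRule × WRule) × WRule =>
    !(DecisionRules.subsetL x.2.1 x.1.2.1 && !DecisionRules.subsetL x.1.2.1 x.2.1))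
    ((subsetL PolyTime.id.snd.fst PolyTime.id.fst.snd.fst).and
      (subsetL PolyTime.id.fst.snd.fst PolyTime.id.snd.fst).not).not

theorem reduceADL : PolyTime reduceADL := by
  refine PolyTime.id.filter (f := fun x : List WRule × WRule => x.1.all fun r' =>
    !decide (r'.2 = x.2.2) ||
    !(DecisionRules.subsetL r'.1 x.2.1 && !DecisionRules.subsetL x.2.1 r'.1)) ?_
  exact PolyTime.id.fst.all (f := fun x : (List WRule × WRule) × WRule =>
    !decide (x.2.2 = x.1.2.2) ||
    !(DecisionRules.subsetL x.2.1 x.1.2.1 && !DecisionRules.subsetL x.1.2.1 x.2.1))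
    ((PolyTime.id.snd.snd.beq PolyTime.id.fst.snd.snd).not.or
    ((subsetL PolyTime.id.snd.fst PolyTime.id.fst.snd.fst).and
      (subsetL PolyTime.id.fst.snd.fst PolyTime.id.snd.fst).not).not)

theorem adaptL {w : γ → List WRule} {p : γ → Eqn} (hw : PolyTime w) (hp : PolyTime p) :
    PolyTime fun c => adaptL (w c) (p c) := by
  refine hp.fst.pair (cond ?_ hp.snd (.const none))
  refine hw.any (f := fun x : γ × WRule =>
    x.2.1.any fun e => decide ((e.1, Option.some e.2) = p x.1)) ?_
  exact PolyTime.id.snd.fst.any (f := fun x : (γ × WRule) × ℕ × ℕ =>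
    decide ((x.2.1, Option.some x.2.2) = p x.1.1))
    ((PolyTime.id.snd.fst.pair PolyTime.id.snd.snd.some).beq (hp.comp PolyTime.id.fst.fst))

variable {I : List WRule → List WRule}

theorem stateL (hI : PolyTime I) {w : γ → List WRule} {ξ : γ → List Eqn} (hw : PolyTime w)
    (hξ : PolyTime ξ) : PolyTime fun c => stateL I (w c) (ξ c) := by
  refine hI.comp (restrictL hw (hξ.map (f := fun x : γ × Eqn =>
    DecisionRules.adaptL (w x.1) x.2) ?_))
  exact adaptL (hw.comp PolyTime.id.fst) PolyTime.id.snd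

theorem stepL (hI : PolyTime I) {w : γ → List WRule} {tl ξ : γ → List Eqn} (hw : PolyTime w)
    (htl : PolyTime tl) (hξ : PolyTime ξ) : PolyTime fun c => stepL I (w c) (tl c) (ξ c) := by
  refine cond ?_ hξ (hξ.append ?_)
  · exact (stateL hI hw hξ).all (f := fun x : γ × WRule => x.2.1.isEmpty)
      PolyTime.id.snd.fst.isEmpty
  · refine htl.filter (f := fun x : γ × Eqn => pickL I (w x.1) (ξ x.1) x.2.1) ?_
    exact ((coverL (plusL (stateL hI hw hξ))).comp PolyTime.id.fst).any
      (f := fun x : (γ × Eqn) × ℕ => decide (x.2 = x.1.2.1))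
      (PolyTime.id.snd.beq PolyTime.id.fst.snd.fst)

/-- Each step appends a sublist of the tuple list, so the size grows by at most `csize (tl c)` per
step, and the number of steps is at most that size too; hence `q * q + 1`. -/
theorem runL (hI : PolyTime I) {w : γ → List WRule} {tl : γ → List Eqn} (hw : PolyTime w)
    (htl : PolyTime tl) : PolyTime fun c => runL I (w c) (tl c) := by
  obtain ⟨q, hq⟩ := htl.exists_csize_le
  refine foldl (f := fun x : γ × List Eqn × Eqn => DecisionRules.stepL I (w x.1) (tl x.1) x.2.1)
    htl (.const []) (stepL hI (hw.comp PolyTime.id.fst) (htl.comp PolyTime.id.fst)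
      PolyTime.id.snd.fst) ⟨q * q + 1, fun c k hk => ?_⟩
  have hstep : ∀ ξ, csize (DecisionRules.stepL I (w c) (tl c) ξ) ≤ csize ξ + csize (tl c) := by
    intro ξ
    rw [DecisionRules.stepL]
    cases doneL I (w c) ξ
    · have h1 := csize_append ξ ((tl c).filter fun p => pickL I (w c) ξ p.1)
      have h2 := csize_le_of_sublist
        (List.filter_sublist (l := tl c) (p := fun p => pickL I (w c) ξ p.1))
      simp only [cond_false]
      omega
    · simp
  have hfold : ∀ (k : List Eqn) ξ, csize (k.foldl
      (fun ξ _ => DecisionRules.stepL I (w c) (tl c) ξ) ξ) ≤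
      csize ξ + k.length * csize (tl c) := by
    intro k
    induction k with
    | nil => intro ξ; simp
    | cons a k ih =>
      intro ξ
      have h1 := ih (DecisionRules.stepL I (w c) (tl c) ξ)
      have h2 := hstep ξ
      rw [List.foldl_cons, List.length_cons, Nat.succ_mul]
      omega
  refine (hfold k []).trans ?_
  have h1 := hk.length_le.trans ((length_le_csize (tl c)).trans (hq c))
  have h2 := Nat.mul_le_mul h1 (hq c)
  simp only [csize_nil, Polynomial.eval_add, Polynomial.eval_mul, Polynomial.eval_one]
  omega

theorem resultL {w : γ → List WRule} {ξ : γ → List Eqn} (hw : PolyTime w) (hξ : PolyTime ξ) :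
    PolyTime fun c => resultL (w c) (ξ c) := by
  refine hw.filter (f := fun x : γ × WRule => x.2.1.all fun e =>
    (ξ x.1).any fun p => decide (p = (e.1, Option.some e.2))) ?_
  exact PolyTime.id.snd.fst.all (f := fun x : (γ × WRule) × ℕ × ℕ =>
    (ξ x.1.1).any fun p => decide (p = (x.2.1, Option.some x.2.2)))
    (any_eqn (hξ.comp PolyTime.id.fst.fst) PolyTime.id.snd)

theorem algL {R I : List WRule → List WRule} (hR : PolyTime R) (hI : PolyTime I) :
    PolyTime (algL R I) := by
  have h1 : PolyTime fun x : List WRule × List Eqn => R x.1 := hR.comp PolyTime.id.fst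
  have h2 := runL hI h1 PolyTime.id.snd
  exact h2.pair (resultL h1 h2)

end PolyTime

/-! ## Greedy covers -/

theorem Rule.card_attrs (r : Rule) : r.attrs.card = r.length :=
  Finset.card_image_of_injOn fun e he e' he' h => r.distinct e he e' he' h

theorem Rule.mem_attrs {r : Rule} {a : ℕ} : a ∈ r.attrs ↔ ∃ v, (a, v) ∈ r.lhs := by
  simp [Rule.attrs]

theorem attrs_subset_attributes {S : Finset Rule} {r : Rule} (hr : r ∈ S) :
    r.attrs ⊆ attributes S := Finset.subset_biUnion_of_mem Rule.attrs hr

theorem attributes_mono {S T : Finset Rule} (h : S ⊆ T) : attributes S ⊆ attributes T :=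
  Finset.biUnion_subset_biUnion_of_subset_left _ h

/-- A rule without attributes is disjoint from every chosen rule, so it is never removed and the
process cannot end with no rules. -/
theorem GreedyCover.nonempty {T : Finset Rule} {B : Finset ℕ} (h : GreedyCover T B) :
    ∀ r ∈ T, r.attrs.Nonempty := by
  induction h with
  | done => simp
  | step T r B _ _ ih =>
    intro r' hr'
    by_contra hne
    rw [Finset.not_nonempty_iff_eq_empty] at hne
    exact absurd (ih r' (Finset.mem_filter.2 ⟨hr', by simp [hne]⟩)) (by simp [hne])

theorem GreedyCover.isNodeCover {T : Finset Rule} {B : Finset ℕ} (h : GreedyCover T B) :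
    IsNodeCover T B := by
  induction h with
  | done => exact ⟨by simp, by simp⟩
  | step T r B hr _ ih =>
    refine ⟨Finset.union_subset (attrs_subset_attributes hr)
      (ih.1.trans (attributes_mono (Finset.filter_subset _ _))), fun r' hr' hne => ?_⟩
    by_cases hd : r.attrs ∩ r'.attrs = ∅
    · obtain ⟨a, ha⟩ := ih.2 r' (Finset.mem_filter.2 ⟨hr', hd⟩) hne
      simp only [Finset.mem_inter] at ha
      exact ⟨a, by simp [ha.1, ha.2]⟩
    · obtain ⟨a, ha⟩ := Finset.nonempty_iff_ne_empty.2 hd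
      simp only [Finset.mem_inter] at ha
      exact ⟨a, by simp [ha.1, ha.2]⟩

/-- When `r` is chosen, `B'` loses at least one element by deleting `A(r)`, and what remains still
meets all rules disjoint from `r`. So each step adds at most `d` attributes at the expense of one
element of `B'`. -/
theorem GreedyCover.card_le {T : Finset Rule} {B : Finset ℕ} (h : GreedyCover T B) {d : ℕ}
    (hd : ∀ r ∈ T, r.length ≤ d) (B' : Finset ℕ) (hB' : ∀ r ∈ T, (r.attrs ∩ B').Nonempty) :
    B.card ≤ B'.card * d := by
  induction h generalizing B' with
  | done => simp
  | step T r B hr _ ih =>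
    have h1 := ih (fun r' hr' => hd r' (Finset.mem_filter.1 hr').1) (B' \ r.attrs)
      fun r' hr' => by
        rw [Finset.mem_filter] at hr'
        obtain ⟨a, ha⟩ := hB' r' hr'.1
        simp only [Finset.mem_inter] at ha
        refine ⟨a, ?_⟩
        simp only [Finset.mem_inter, Finset.mem_sdiff]
        refine ⟨ha.1, ha.2, fun ha' => ?_⟩
        have : a ∈ r.attrs ∩ r'.attrs := Finset.mem_inter.2 ⟨ha', ha.1⟩
        simp [hr'.2] at this
    have h2 : (B' \ r.attrs).card + 1 ≤ B'.card := by
      obtain ⟨a, ha⟩ := hB' r hr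
      simp only [Finset.mem_inter] at ha
      exact Finset.card_lt_card (Finset.ssubset_iff_of_subset Finset.sdiff_subset |>.2
        ⟨a, ha.2, by simp [ha.1]⟩)
    have h3 := hd r hr
    have h4 := Finset.card_union_le r.attrs B
    rw [r.card_attrs] at h4
    have h5 := Nat.mul_le_mul_right d h2
    rw [Nat.succ_mul] at h5
    omega

theorem exists_isNodeCover_card_eq (S : Finset Rule) :
    ∃ B : Finset ℕ, IsNodeCover S B ∧ B.card = coverNumber S :=
  Nat.sInf_mem (s := {k : ℕ | ∃ B : Finset ℕ, IsNodeCover S B ∧ B.card = k})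
    ⟨_, attributes S, ⟨Finset.Subset.refl _, fun r hr h => by
      rwa [Finset.inter_eq_left.2 (attrs_subset_attributes hr)]⟩, rfl⟩

/-- Lets a cover contain foreign attributes; intersecting it with `A(S)` removes them. -/
theorem coverNumber_le {S : Finset Rule} {B : Finset ℕ}
    (hB : ∀ r ∈ S, r.attrs.Nonempty → (r.attrs ∩ B).Nonempty) : coverNumber S ≤ B.card := by
  refine le_trans (b := (B ∩ attributes S).card) (Nat.sInf_le ⟨B ∩ attributes S,
    ⟨Finset.inter_subset_right, fun r hr h => ?_⟩, rfl⟩)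
    (Finset.card_le_card Finset.inter_subset_left)
  obtain ⟨a, ha⟩ := hB r hr h
  rw [Finset.mem_inter] at ha
  exact ⟨a, by simp [ha.1, ha.2, attrs_subset_attributes hr ha.1]⟩

theorem length_le_maxLen {S : Finset Rule} {r : Rule} (hr : r ∈ S) : r.length ≤ maxLen S :=
  Finset.le_sup (f := Rule.length) hr

theorem GreedyCover.card_le_coverNumber {T : Finset Rule} {B : Finset ℕ}
    (h : GreedyCover (plus T) B) : B.card ≤ coverNumber (plus T) * maxLen T := by
  obtain ⟨B', hB', hc⟩ := exists_isNodeCover_card_eq (plus T)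
  rw [← hc]
  exact h.card_le (fun r hr => (Finset.mem_filter.1 hr).2.le) B'
    fun r hr => hB'.2 r hr (h.nonempty r hr)

/-! ## Restrictions of a rule system to a part of a tuple -/

theorem mem_tupleEqs {δ : ℕ → Option ℕ} {Q : Finset ℕ} {e : ℕ × Option ℕ} :
    e ∈ tupleEqs δ Q ↔ e.1 ∈ Q ∧ δ e.1 = e.2 := by
  simp only [tupleEqs, Finset.mem_image]
  constructor
  · rintro ⟨a, ha, rfl⟩; exact ⟨ha, rfl⟩
  · rintro ⟨h1, h2⟩; exact ⟨e.1, h1, by rw [h2]⟩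

theorem Rule.mem_eqs {r : Rule} {e : ℕ × Option ℕ} :
    e ∈ r.eqs ↔ ∃ v, e.2 = some v ∧ (e.1, v) ∈ r.lhs := by
  obtain ⟨a, b⟩ := e
  simp only [Rule.eqs, Finset.mem_image, Prod.mk.injEq]
  constructor
  · rintro ⟨e', h, rfl, rfl⟩; exact ⟨e'.2, rfl, h⟩
  · rintro ⟨v, rfl, h⟩; exact ⟨(a, v), h, rfl, rfl⟩

/-- Neither a rule nor a tuple contradicts itself, so only conflicts between the two have to be
excluded. -/
theorem consistent_union_tupleEqs {r : Rule} {δ : ℕ → Option ℕ} {Q : Finset ℕ} :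
    Consistent (r.eqs ∪ tupleEqs δ Q) ↔ ∀ e ∈ r.lhs, e.1 ∈ Q → δ e.1 = some e.2 := by
  constructor
  · intro h e he hQ
    exact h (e.1, δ e.1) (Finset.mem_union_right _ (mem_tupleEqs.2 ⟨hQ, rfl⟩)) (e.1, some e.2)
      (Finset.mem_union_left _ (Rule.mem_eqs.2 ⟨e.2, rfl, he⟩)) rfl
  · rintro h ⟨a, x⟩ he ⟨a', x'⟩ he' (rfl : a = a')
    simp only [Finset.mem_union, mem_tupleEqs, Rule.mem_eqs] at he he' ⊢
    rcases he with ⟨v, rfl, hv⟩ | ⟨hQ, rfl⟩ <;> rcases he' with ⟨v', rfl, hv'⟩ | ⟨hQ', rfl⟩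
    · rw [(Prod.mk.inj (r.distinct _ hv _ hv' rfl)).2]
    · exact (h _ hv hQ').symm
    · exact h _ hv' hQ
    · rfl

theorem eqs_subset_tupleEqs {r : Rule} {δ : ℕ → Option ℕ} {Q : Finset ℕ} :
    r.eqs ⊆ tupleEqs δ Q ↔ Consistent (r.eqs ∪ tupleEqs δ Q) ∧ r.attrs ⊆ Q := by
  rw [consistent_union_tupleEqs]
  constructor
  · intro h
    have h' : ∀ e ∈ r.lhs, e.1 ∈ Q ∧ δ e.1 = some e.2 := fun e he =>
      mem_tupleEqs.1 (h (Rule.mem_eqs.2 ⟨e.2, rfl, he⟩ : (e.1, some e.2) ∈ r.eqs))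
    refine ⟨fun e he _ => (h' e he).2, fun a ha => ?_⟩
    obtain ⟨v, hv⟩ := Rule.mem_attrs.1 ha
    exact (h' _ hv).1
  · rintro ⟨h1, h2⟩ ⟨a, x⟩ he
    obtain ⟨v, rfl, hv⟩ := Rule.mem_eqs.1 he
    have := h2 (Rule.mem_attrs.2 ⟨v, hv⟩)
    exact mem_tupleEqs.2 ⟨this, h1 _ hv this⟩

theorem Rule.attrs_remove {r : Rule} {δ : ℕ → Option ℕ} {Q : Finset ℕ}
    (h : Consistent (r.eqs ∪ tupleEqs δ Q)) : (r.remove (tupleEqs δ Q)).attrs = r.attrs \ Q := by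
  rw [consistent_union_tupleEqs] at h
  ext a
  simp only [Rule.mem_attrs, Finset.mem_sdiff, Rule.remove, Finset.mem_filter, mem_tupleEqs]
  constructor
  · rintro ⟨v, hv, hn⟩
    exact ⟨⟨v, hv⟩, fun hQ => hn ⟨hQ, h _ hv hQ⟩⟩
  · rintro ⟨⟨v, hv⟩, hn⟩
    exact ⟨v, hv, fun hQ => hn hQ.1⟩

theorem Rule.length_eq_zero {r : Rule} : r.length = 0 ↔ r.attrs = ∅ := by
  rw [← r.card_attrs, Finset.card_eq_zero]

theorem Rule.length_remove_eq_zero {r : Rule} {δ : ℕ → Option ℕ} {Q : Finset ℕ}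
    (h : Consistent (r.eqs ∪ tupleEqs δ Q)) :
    (r.remove (tupleEqs δ Q)).length = 0 ↔ r.attrs ⊆ Q := by
  rw [Rule.length_eq_zero, Rule.attrs_remove h, Finset.sdiff_eq_empty_iff_subset]

theorem mem_restrict {S : Finset Rule} {α : EqSystem} {r' : Rule} :
    r' ∈ restrict S α ↔ ∃ r ∈ S, Consistent (r.eqs ∪ α) ∧ r.remove α = r' := by
  simp [restrict, and_assoc]

theorem tupleEqs_empty (δ : ℕ → Option ℕ) : tupleEqs δ ∅ = ∅ := rfl

theorem restrict_empty (S : Finset Rule) : restrict S ∅ = S := by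
  have h : ∀ r : Rule, r.remove ∅ = r := fun r => by
    ext1 <;> simp [Rule.remove]
  have h' : ∀ r : Rule, Consistent (r.eqs ∪ ∅) := fun r => by
    simpa [tupleEqs_empty] using
      (consistent_union_tupleEqs (r := r) (δ := fun _ => none) (Q := ∅)).2 (by simp)
  ext r
  simp only [mem_restrict, h, h', true_and, exists_eq_right]

/-! ## What the problems have in common -/

/-- The rule `r₀` in a terminal node makes it unnecessary to have the rule `r` there. -/
def Problem.Covers : Problem → Rule → Rule → Prop
  | .AR, r₀, r | .EAR, r₀, r => r₀ = r
  | .AD, r₀, r | .EAD, r₀, r => r₀.rhs = r.rhs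
  | .SR, _, _ | .ESR, _, _ => True

theorem Problem.Covers.refl (C : Problem) (r : Rule) : C.Covers r r := by
  cases C <;> simp [Problem.Covers]

theorem Problem.Covers.trans {C : Problem} {r r' r'' : Rule} (h : C.Covers r r')
    (h' : C.Covers r' r'') : C.Covers r r'' := by
  cases C <;> simp_all [Problem.Covers]

/-- The common form in which all six problems are used from here on. Under `AR` a covering rule is
the rule itself, under `AD` it shares the right-hand side, and under `SR` any attached rule will do.
-/
theorem Problem.accepts_iff {C : Problem} {S : Finset Rule} {K : EqSystem} {τ : Finset Rule} :
    C.Accepts S K τ ↔ (∀ r ∈ τ, r.eqs ⊆ K) ∧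
      ∀ r ∈ S, Consistent (r.eqs ∪ K) → ∃ r₀ ∈ τ, C.Covers r₀ r := by
  unfold Problem.Accepts
  refine and_congr_right fun _ => ?_
  cases C <;> simp only [Problem.Covers, Finset.mem_sdiff, Finset.mem_image, exists_eq_right,
    and_true, and_imp, not_exists, not_and]
  all_goals first
    | exact forall₂_congr fun r _ => by tauto
    | (rw [← Finset.not_nonempty_iff_eq_empty]
       constructor
       · intro h r hr hc
         by_contra hn
         exact h hn r hr hc
       · exact fun h hn r hr hc => hn (h r hr hc))
    | (refine forall₂_congr fun r _ => ⟨fun h hc => ?_, fun h _ hn hc => ?_⟩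
       · by_contra hn
         push Not at hn
         exact h (fun hr => hn r hr rfl) hn hc
       · obtain ⟨r₀, h0, h1⟩ := h hc
         exact hn r₀ h0 h1)

/-- The problems with algorithms of their own. -/
def Problem.Basic (C : Problem) : Prop := C = .AR ∨ C = .EAR ∨ C = .EAD ∨ C = .ESR

theorem Problem.inner_subset (C : Problem) (T : Finset Rule) : C.inner T ⊆ T := by
  cases C <;> simp only [Problem.inner, innerAD, innerSR] <;>
    first | exact Finset.Subset.refl _ | exact Finset.filter_subset _ _ | skip
  split_ifs
  · exact Finset.Subset.refl _
  · exact Finset.filter_subset _ _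

/-- The rules of length `0` in `S_α` come exactly from the rules realized by `α`, so what `I_C`
discards can be read off from those. For `AR` and `EAR` nothing is discarded, and the right side
holds because an unfinished rule is not realized. -/
theorem Problem.remove_mem_inner {C : Problem} (hC : C.Basic) {S : Finset Rule} {r : Rule}
    {δ : ℕ → Option ℕ} {Q : Finset ℕ} (hr : r ∈ S) (hc : Consistent (r.eqs ∪ tupleEqs δ Q))
    (hQ : ¬ r.attrs ⊆ Q) :
    r.remove (tupleEqs δ Q) ∈ C.inner (restrict S (tupleEqs δ Q)) ↔
      ∀ r₀ ∈ S, r₀.eqs ⊆ tupleEqs δ Q → ¬ C.Covers r₀ r := by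
  have hmem : r.remove (tupleEqs δ Q) ∈ restrict S (tupleEqs δ Q) := mem_restrict.2 ⟨r, hr, hc, rfl⟩
  have hlen := mt (Rule.length_remove_eq_zero hc).1 hQ
  -- A general `P` serves both operators: `EAD` compares right-hand sides, while `ESR` takes `P`
  -- constantly false and asks only whether a rule of length `0` exists.
  have hzero : ∀ P : ℕ → Prop,
      (∀ r' ∈ restrict S (tupleEqs δ Q), r'.length = 0 → P r'.rhs) ↔
        ∀ r₀ ∈ S, r₀.eqs ⊆ tupleEqs δ Q → P r₀.rhs := by
    intro P
    constructor
    · intro h r₀ h0 h1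
      rw [eqs_subset_tupleEqs] at h1
      exact h (r₀.remove (tupleEqs δ Q)) (mem_restrict.2 ⟨r₀, h0, h1.1, rfl⟩)
        ((Rule.length_remove_eq_zero h1.1).2 h1.2)
    · intro h r' h0 h1
      obtain ⟨r₀, h3, h2, rfl⟩ := mem_restrict.1 h0
      exact h r₀ h3 (eqs_subset_tupleEqs.2 ⟨h2, (Rule.length_remove_eq_zero h2).1 h1⟩)
  have hself : ∀ r₀ ∈ S, r₀.eqs ⊆ tupleEqs δ Q → ¬ r₀ = r := by
    rintro r₀ - h1 rfl
    exact hQ (eqs_subset_tupleEqs.1 h1).2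
  rcases hC with rfl | rfl | rfl | rfl
  · exact iff_of_true hmem hself
  · exact iff_of_true hmem hself
  · simp only [Problem.inner, innerAD, Finset.mem_filter, hmem, hlen, true_and, false_or,
      Problem.Covers]
    exact hzero fun n => n ≠ r.rhs
  · simp only [Problem.inner, Problem.Covers]
    have := hzero fun _ => False
    simp only [imp_false] at this
    rw [not_true, ← this, innerSR]
    split_ifs with h
    · exact iff_of_true hmem h
    · exact iff_of_false (fun h' => hlen (Finset.mem_filter.1 h').2) h

/-- Computing the values of a node cover of the longest rules makes the rules shorter. -/
theorem maxLen_inner_lt {C : Problem} (hC : C.Basic) {S : Finset Rule} {δ : ℕ → Option ℕ}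
    {Q B : Finset ℕ}
    (hn : ¬ ∀ r ∈ C.inner (restrict S (tupleEqs δ Q)), r.length = 0)
    (hB : IsNodeCover (plus (C.inner (restrict S (tupleEqs δ Q)))) B) :
    maxLen (C.inner (restrict S (tupleEqs δ (Q ∪ B)))) <
      maxLen (C.inner (restrict S (tupleEqs δ Q))) := by
  push Not at hn
  obtain ⟨r1, hr1, hl1⟩ := hn
  have hpos := (Nat.pos_of_ne_zero hl1).trans_le (length_le_maxLen hr1)
  -- A strict bound on a supremum in `ℕ` needs `0 < d`, provided by the rule of nonzero length; it
  -- also settles the rules of length `0`.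
  refine (Finset.sup_lt_iff (by simpa using hpos)).2 fun r' hr' => ?_
  rcases Nat.eq_zero_or_pos r'.length with h0 | h0
  · rwa [h0]
  obtain ⟨r, hr, hc, rfl⟩ := mem_restrict.1 (C.inner_subset _ hr')
  have hnQ' : ¬ r.attrs ⊆ Q ∪ B := fun h => h0.ne' ((Rule.length_remove_eq_zero hc).2 h)
  have hcQ : Consistent (r.eqs ∪ tupleEqs δ Q) := by
    rw [consistent_union_tupleEqs] at hc ⊢
    exact fun e he hQ => hc e he (Finset.mem_union_left _ hQ)
  have hnQ : ¬ r.attrs ⊆ Q := fun h => hnQ' (h.trans Finset.subset_union_left)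
  -- A rule realized on `Q` stays realized on `Q ∪ B`, so an unfinished rule kept by `I_C` after the
  -- round was also kept before it.
  have hmem : r.remove (tupleEqs δ Q) ∈ C.inner (restrict S (tupleEqs δ Q)) := by
    rw [Problem.remove_mem_inner hC hr hcQ hnQ]
    intro r₀ h0 h1
    exact (Problem.remove_mem_inner hC hr hc hnQ').1 hr' r₀ h0
      (h1.trans (Finset.image_subset_image Finset.subset_union_left))
  have hle := length_le_maxLen hmem
  have h1 : (r.remove (tupleEqs δ (Q ∪ B))).attrs = (r.remove (tupleEqs δ Q)).attrs \ B := by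
    rw [Rule.attrs_remove hc, Rule.attrs_remove hcQ]
    ext a
    simp only [Finset.mem_sdiff, Finset.mem_union]
    tauto
  -- A rule below the maximum length cannot grow; one of maximum length contains an attribute of the
  -- cover and loses it.
  rcases hle.lt_or_eq with hlt | heq
  · rw [← Rule.card_attrs, h1]
    exact (Finset.card_le_card Finset.sdiff_subset).trans_lt ((Rule.card_attrs _).trans_lt hlt)
  · have hne : (r.remove (tupleEqs δ Q)).attrs.Nonempty := by
      rw [← Finset.card_pos, Rule.card_attrs, heq]; exact hpos
    obtain ⟨a, ha⟩ := hB.2 _ (Finset.mem_filter.2 ⟨hmem, heq⟩) hne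
    rw [Finset.mem_inter] at ha
    rw [← heq, ← Rule.card_attrs, ← Rule.card_attrs, h1]
    exact Finset.card_lt_card (Finset.ssubset_iff_of_subset Finset.sdiff_subset |>.2
      ⟨a, ha.1, by simp [ha.2]⟩)

theorem Rounds.finished {I : Finset Rule → Finset Rule} {S : Finset Rule} {δ : ℕ → Option ℕ}
    {Q : Finset ℕ} {s : List ℕ} (h : Rounds I S δ Q s) :
    ∀ r ∈ I (restrict S (tupleEqs δ (Q ∪ s.toFinset))), r.length = 0 := by
  induction h with
  | finish Q h => simpa using h
  | round Q b s _ _ _ _ ih => simpa [Finset.union_assoc] using ih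

/-- When the work is finished, each rule that is still possible is covered by a realized one. -/
theorem exists_covers {C : Problem} (hC : C.Basic) {S : Finset Rule} {δ : ℕ → Option ℕ}
    {Q : Finset ℕ} (hfin : ∀ r ∈ C.inner (restrict S (tupleEqs δ Q)), r.length = 0)
    {r : Rule} (hr : r ∈ S) (hc : Consistent (r.eqs ∪ tupleEqs δ Q)) :
    ∃ r₀ ∈ S, r₀.eqs ⊆ tupleEqs δ Q ∧ C.Covers r₀ r := by
  by_cases hQ : r.attrs ⊆ Q
  · exact ⟨r, hr, eqs_subset_tupleEqs.2 ⟨hc, hQ⟩, .refl C r⟩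
  · by_contra hn
    push Not at hn
    exact hQ ((Rule.length_remove_eq_zero hc).1
      (hfin _ ((Problem.remove_mem_inner hC hr hc hQ).2 hn)))

/-! ## Paths in decision trees -/

theorem mem_values {S : Finset Rule} {ext : Bool} {a : ℕ} {v : Option ℕ} :
    v ∈ values S ext a ↔ (∃ n, v = some n ∧ ∃ r ∈ S, (a, n) ∈ r.lhs) ∨ (ext = true ∧ v = none) := by
  simp only [values, Finset.mem_union, Finset.mem_image, Finset.mem_filter, Finset.mem_biUnion]
  refine or_congr ⟨?_, ?_⟩ ?_
  · rintro ⟨⟨a', n⟩, ⟨⟨r, hr, h⟩, rfl⟩, rfl⟩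
    exact ⟨n, rfl, r, hr, h⟩
  · rintro ⟨n, rfl, r, hr, h⟩
    exact ⟨(a, n), ⟨⟨r, hr, h⟩, rfl⟩, rfl⟩
  · cases ext <;> simp

theorem values_nonempty {S : Finset Rule} {a : ℕ} (ext : Bool) (ha : a ∈ attributes S) :
    (values S ext a).Nonempty := by
  obtain ⟨r, hr, h⟩ := Finset.mem_biUnion.1 ha
  obtain ⟨v, hv⟩ := Rule.mem_attrs.1 h
  exact ⟨some v, mem_values.2 (.inl ⟨v, rfl, r, hr, hv⟩)⟩

/-- The equations `a = v` with `a ∈ A(S)` and `v ∈ V_S(a)` (or `v ∈ EV_S(a)`). -/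
def IsEquation (S : Finset Rule) (ext : Bool) (p : ℕ × Option ℕ) : Prop :=
  p.1 ∈ attributes S ∧ p.2 ∈ values S ext p.1

theorem isEquation_of_mem_eqs {S : Finset Rule} {r : Rule} (hr : r ∈ S) (ext : Bool)
    {p : ℕ × Option ℕ} (hp : p ∈ r.eqs) : IsEquation S ext p := by
  obtain ⟨v, h, hv⟩ := Rule.mem_eqs.1 hp
  exact ⟨attrs_subset_attributes hr (Rule.mem_attrs.2 ⟨v, hv⟩),
    mem_values.2 (.inl ⟨v, h, r, hr, hv⟩)⟩

theorem IsEquation.mono {S S' : Finset Rule} (h : S' ⊆ S) {ext : Bool} {p : ℕ × Option ℕ}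
    (hp : IsEquation S' ext p) : IsEquation S ext p := by
  refine ⟨attributes_mono h hp.1, ?_⟩
  have := hp.2
  rw [mem_values] at this ⊢
  refine this.imp ?_ id
  rintro ⟨n, h1, r, hr, h2⟩
  exact ⟨n, h1, r, h hr, h2⟩

/-- Each consistent system is a part of a tuple; the other values may be `*` if this is allowed. -/
theorem exists_tuple {S : Finset Rule} {ext : Bool} {E : EqSystem} (hE : Consistent E)
    (h : ∀ p ∈ E, IsEquation S ext p) : ∃ δ : ℕ → Option ℕ, IsTuple S ext δ ∧
      (∀ p ∈ E, δ p.1 = p.2) ∧ (ext = true → ∀ a v, δ a = some v → (a, some v) ∈ E) := by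
  classical
  have hval : ∀ a, ∃ v, (a ∈ attributes S → v ∈ values S ext a) ∧ (ext = true → v = none) := by
    intro a
    by_cases ha : a ∈ attributes S
    · cases ext with
      | true => exact ⟨none, fun _ => mem_values.2 (.inr ⟨rfl, rfl⟩), fun _ => rfl⟩
      | false =>
        obtain ⟨v, hv⟩ := values_nonempty false ha
        exact ⟨v, fun _ => hv, by simp⟩
    · exact ⟨none, fun h => absurd h ha, fun _ => rfl⟩
  choose dflt hd using hval
  have hdef : ∀ a, ∃ v, (∀ p ∈ E, p.1 = a → v = p.2) ∧ ((∀ p ∈ E, p.1 ≠ a) → v = dflt a) := by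
    intro a
    by_cases hp : ∃ p ∈ E, p.1 = a
    · obtain ⟨p, hp, rfl⟩ := hp
      exact ⟨p.2, fun p' hp' h' => hE p hp p' hp' h'.symm, fun h => absurd rfl (h p hp)⟩
    · push Not at hp
      exact ⟨dflt a, fun p h1 h2 => absurd h2 (hp p h1), fun _ => rfl⟩
  choose δ h1 h2 using hdef
  refine ⟨δ, fun a ha => ?_, fun p hp => h1 _ p hp rfl, fun hext a v hv => ?_⟩
  · by_cases hp : ∃ p ∈ E, p.1 = a
    · obtain ⟨p, hp, rfl⟩ := hp
      rw [h1 _ p hp rfl]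
      exact (h p hp).2
    · push Not at hp
      rw [h2 a hp]
      exact (hd a).1 ha
  · by_cases hp : ∃ p ∈ E, p.1 = a
    · obtain ⟨p, hp, rfl⟩ := hp
      rw [← hv, h1 _ p hp rfl]
      exact hp
    · push Not at hp
      rw [h2 a hp, (hd a).2 hext] at hv
      cases hv

theorem eq_tupleEqs {E : EqSystem} {δ : ℕ → Option ℕ} (h : ∀ p ∈ E, δ p.1 = p.2) :
    E = tupleEqs δ (E.image Prod.fst) := by
  ext ⟨a, v⟩
  simp only [mem_tupleEqs, Finset.mem_image]
  constructor
  · intro hp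
    exact ⟨⟨_, hp, rfl⟩, h _ hp⟩
  · rintro ⟨⟨p, hp, rfl⟩, rfl⟩
    have := h p hp
    rw [this]
    exact hp

theorem consistent_tupleEqs (δ : ℕ → Option ℕ) (Q : Finset ℕ) : Consistent (tupleEqs δ Q) := by
  intro e he e' he' h
  rw [mem_tupleEqs] at he he'
  rw [← he.2, ← he'.2, h]

namespace DTree

variable {S : Finset Rule} {ext : Bool}

theorem IsPath.length_le {Γ : DTree S ext} {ξ : List (ℕ × Option ℕ)} {τ : Finset Rule}
    (h : Γ.IsPath ξ τ) : ξ.length ≤ Γ.depth := by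
  induction h with
  | leaf τ h => simp
  | node a ha child v ξ τ _ ih =>
    have := Finset.le_sup (f := fun v => (child v).depth) (Finset.mem_univ v)
    simp only [List.length_cons, depth]
    omega

theorem IsPath.subset {Γ : DTree S ext} {ξ : List (ℕ × Option ℕ)} {τ : Finset Rule}
    (h : Γ.IsPath ξ τ) : τ ⊆ S := by
  induction h with
  | leaf τ h => exact h
  | node _ _ _ _ _ _ _ ih => exact ih

theorem IsPath.isEquation {Γ : DTree S ext} {ξ : List (ℕ × Option ℕ)} {τ : Finset Rule}
    (h : Γ.IsPath ξ τ) : ∀ p ∈ ξ, IsEquation S ext p := by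
  induction h with
  | leaf τ h => simp
  | node a ha child v ξ τ _ ih =>
    intro p hp
    rcases List.mem_cons.1 hp with rfl | hp
    · exact ⟨ha, v.2⟩
    · exact ih p hp

theorem IsPath.unique {Γ : DTree S ext} {δ : ℕ → Option ℕ} {ξ ξ' : List (ℕ × Option ℕ)}
    {τ τ' : Finset Rule} (h : Γ.IsPath ξ τ) (h' : Γ.IsPath ξ' τ') (hξ : ∀ p ∈ ξ, δ p.1 = p.2)
    (hξ' : ∀ p ∈ ξ', δ p.1 = p.2) : ξ = ξ' ∧ τ = τ' := by
  induction h generalizing ξ' τ' with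
  | leaf τ h => cases h'; exact ⟨rfl, rfl⟩
  | node a ha child v ξ τ _ ih =>
    cases h' with
    | node _ _ _ v' ξ' τ' h' =>
      have h1 : v = v' := Subtype.ext ((hξ _ (List.mem_cons_self)).symm.trans
        (hξ' _ (List.mem_cons_self)))
      subst h1
      obtain ⟨rfl, rfl⟩ := ih h' (fun p hp => hξ p (List.mem_cons_of_mem _ hp))
        (fun p hp => hξ' p (List.mem_cons_of_mem _ hp))
      exact ⟨rfl, rfl⟩

theorem exists_isPath (Γ : DTree S ext) {δ : ℕ → Option ℕ} (hδ : IsTuple S ext δ) :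
    ∃ ξ τ, Γ.IsPath ξ τ ∧ ∀ p ∈ ξ, δ p.1 = p.2 := by
  induction Γ with
  | leaf τ h => exact ⟨[], τ, .leaf τ h, by simp⟩
  | node a ha child ih =>
    obtain ⟨ξ, τ, h1, h2⟩ := ih ⟨δ a, hδ a ha⟩
    refine ⟨_, τ, .node a ha child _ ξ τ h1, fun p hp => ?_⟩
    rcases List.mem_cons.1 hp with rfl | hp
    · rfl
    · exact h2 p hp

end DTree

/-! ## Lower bounds on the depth -/

/-- The rules of `S'` replace those of `S` in the problem `C`. -/
def Problem.Reduces (C : Problem) (S S' : Finset Rule) : Prop :=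
  S' ⊆ S ∧ ∀ r ∈ S, ∃ r' ∈ S', r'.lhs ⊆ r.lhs ∧ C.Covers r' r

/-- No rule of `S` makes a longer rule of `S'` superfluous. -/
def Problem.Minimal (C : Problem) (S S' : Finset Rule) : Prop :=
  ∀ r ∈ S', ∀ r₀ ∈ S, r₀.lhs ⊆ r.lhs → C.Covers r₀ r → r₀.lhs = r.lhs

theorem eqs_subset_eqs {r r' : Rule} : r.eqs ⊆ r'.eqs ↔ r.lhs ⊆ r'.lhs := by
  constructor
  · intro h e he
    obtain ⟨v, h1, h2⟩ := Rule.mem_eqs.1 (h (Rule.mem_eqs.2 ⟨e.2, rfl, he⟩ : (e.1, some e.2) ∈ _))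
    simp only [Option.some.injEq] at h1
    rwa [← h1] at h2
  · exact Finset.image_subset_image

theorem consistent_eqs (r : Rule) : Consistent r.eqs := by
  intro e he e' he' h
  obtain ⟨v, h1, h2⟩ := Rule.mem_eqs.1 he
  obtain ⟨v', h1', h2'⟩ := Rule.mem_eqs.1 he'
  have := r.distinct _ h2 _ h2' h
  rw [h1, h1', (Prod.mk.inj this).2]

section lower

variable {C : Problem} {S S' : Finset Rule}

/-- On a tuple realizing `r`, the tree must attach a rule covering `r`. By minimality that rule has
the left-hand side of `r`, so all equations of `r` lie on the path. -/
theorem maxLen_le_depth (hC : C.Basic) (hR : C.Reduces S S') (hM : C.Minimal S S')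
    {Γ : DTree S C.ext} (hΓ : Γ.Solves C) : maxLen S' ≤ Γ.depth := by
  refine Finset.sup_le fun r hr => ?_
  obtain ⟨δ, hδ, h1, h2⟩ := exists_tuple (consistent_eqs r) fun p hp =>
    isEquation_of_mem_eqs (hR.1 hr) C.ext hp
  obtain ⟨ξ, τ, hξ, h3⟩ := Γ.exists_isPath hδ
  have h3' : ∀ p ∈ ξ.toFinset, δ p.1 = p.2 := by simpa using h3
  have hK := eq_tupleEqs h3'
  have hcons := consistent_tupleEqs δ (ξ.toFinset.image Prod.fst)
  rw [← hK] at hcons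
  obtain ⟨h4, h5⟩ := Problem.accepts_iff.1 (hΓ.2 ξ τ hξ hcons)
  obtain ⟨r₀, h6, h7⟩ := h5 r (hR.1 hr) (by
    rw [hK, consistent_union_tupleEqs]
    exact fun e he _ => h1 (e.1, some e.2) (Rule.mem_eqs.2 ⟨e.2, rfl, he⟩))
  have hr₀S : r₀ ∈ S := hξ.subset h6
  have heq : r₀.lhs = r.lhs := by
    -- For each basic problem either `*` is available or covering means equality.
    have hext : C.ext = true ∨ ∀ r r', C.Covers r r' → r = r' := by
      rcases hC with rfl | rfl | rfl | rfl <;> simp [Problem.ext, Problem.Covers]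
    rcases hext with hext | hext
    -- All values of `δ` other than `*` come from `K(r)`, so a realized rule has its equations in
    -- `K(r)`.
    · refine hM r hr r₀ hr₀S (eqs_subset_eqs.1 fun p hp => ?_) h7
      obtain ⟨v, hv, -⟩ := Rule.mem_eqs.1 hp
      have := h3' p (h4 _ h6 hp)
      have := h2 hext p.1 v (this.trans hv)
      rwa [← hv] at this
    · rw [hext _ _ h7]
  calc r.length = r.eqs.card := by
        rw [Rule.eqs, Finset.card_image_of_injective]
        · rfl
        · rintro ⟨a, b⟩ ⟨a', b'⟩ h; simpa using h
    _ ≤ ξ.toFinset.card := Finset.card_le_card fun p hp => h4 r₀ h6 (by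
        rwa [Rule.eqs, heq])
    _ ≤ ξ.length := List.toFinset_card_le ξ
    _ ≤ Γ.depth := hξ.length_le

theorem mem_eqSystems {ext : Bool} {α : EqSystem} :
    α ∈ eqSystems S ext ↔ (∀ p ∈ α, IsEquation S ext p) ∧ Consistent α := by
  simp only [eqSystems, Finset.mem_filter, Finset.mem_powerset]
  refine and_congr_left fun _ => forall₂_congr fun p _ => ?_
  simp only [Finset.mem_biUnion, Finset.mem_image, IsEquation]
  constructor
  · rintro ⟨a, ha, v, hv, rfl⟩; exact ⟨ha, hv⟩
  · rintro ⟨h1, h2⟩; exact ⟨_, h1, _, h2, rfl⟩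

/-- Complete `α` to a tuple, with `*` elsewhere when allowed, and follow it. If the path missed a
rule kept by `I_C(S'_α)`, then that rule would still be possible and the tree would have to attach a
covering rule; the completion makes this impossible. -/
theorem betaPlus_le_depth (hC : C.Basic) (hR : C.Reduces S S') {Γ : DTree S C.ext}
    (hΓ : Γ.Solves C) : betaPlus C S' ≤ Γ.depth := by
  refine Finset.sup_le fun α hα => ?_
  obtain ⟨hα, hαc⟩ := mem_eqSystems.1 hα
  obtain ⟨δ, hδ, h1, h2⟩ := exists_tuple hαc fun p hp => (hα p hp).mono hR.1
  obtain ⟨ξ, τ, hξ, h3⟩ := Γ.exists_isPath hδ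
  have h3' : ∀ p ∈ ξ.toFinset, δ p.1 = p.2 := by simpa using h3
  have hK := eq_tupleEqs h3'
  have hcons := consistent_tupleEqs δ (ξ.toFinset.image Prod.fst)
  rw [← hK] at hcons
  obtain ⟨h4, h5⟩ := Problem.accepts_iff.1 (hΓ.2 ξ τ hξ hcons)
  refine le_trans (coverNumber_le (B := ξ.toFinset.image Prod.fst) fun r' hr' hne => ?_)
    ((Finset.card_image_le.trans (List.toFinset_card_le ξ)).trans hξ.length_le)
  have hαe := eq_tupleEqs h1
  set Q := α.image Prod.fst with hQ
  rw [hαe] at hr'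
  have hr' := (Finset.mem_filter.1 hr').1
  obtain ⟨r, hr, hc, rfl⟩ := mem_restrict.1 (C.inner_subset _ hr')
  rw [Rule.attrs_remove hc] at hne ⊢
  have hnQ : ¬ r.attrs ⊆ Q := by rwa [← Finset.sdiff_eq_empty_iff_subset, ← ne_eq,
    ← Finset.nonempty_iff_ne_empty]
  have hkey := (Problem.remove_mem_inner hC hr hc hnQ).1 hr'
  by_cases hrc : Consistent (r.eqs ∪ ξ.toFinset)
  · obtain ⟨r₀, h6, h7⟩ := h5 r (hR.1 hr) hrc
    have hext : C.ext = true ∨ ∀ r r', C.Covers r r' → r = r' := by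
      rcases hC with rfl | rfl | rfl | rfl <;> simp [Problem.ext, Problem.Covers]
    have h0 := h4 r₀ h6
    -- With `*` available, the attached rule uses only equations of `α`. It contains a rule of `S'`
    -- that is realized by `α` and covers `r`, against `hkey`. Otherwise the attached rule is `r`
    -- itself and the path contains all its attributes.
    rcases hext with hext | hext
    · have hτ : r₀ ∈ S := hξ.subset h6
      obtain ⟨r₁, h8, h9, h10⟩ := hR.2 r₀ hτ
      refine absurd (h10.trans h7) (hkey r₁ h8 fun p hp => ?_)
      have hp' := eqs_subset_eqs.2 h9 hp
      obtain ⟨v, hv, -⟩ := Rule.mem_eqs.1 hp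
      have := h2 hext p.1 v ((h3' p (h0 hp')).trans hv)
      rw [← hv] at this
      rwa [← hαe]
    · rw [hext _ _ h7, hK, eqs_subset_tupleEqs] at h0
      rwa [Finset.inter_eq_left.2 (Finset.sdiff_subset.trans h0.2)]
  -- The attribute in conflict is on the path. Since `r` is consistent with `α`, it is not an
  -- attribute of `α` and so still occurs in `r_α`.
  · rw [hK, consistent_union_tupleEqs] at hrc
    push Not at hrc
    obtain ⟨e, he, h8, h9⟩ := hrc
    refine ⟨e.1, Finset.mem_inter.2 ⟨Finset.mem_sdiff.2 ⟨Rule.mem_attrs.2 ⟨e.2, he⟩, ?_⟩, h8⟩⟩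
    exact fun hQ => h9 (consistent_union_tupleEqs.1 hc e he hQ)

theorem maxLen_mono {T T' : Finset Rule} (h : T ⊆ T') : maxLen T ≤ maxLen T' := Finset.sup_mono h

/-- A tree of a depth at most `d² β⁺` has a depth at most the cube of the minimum. -/
theorem le_minDepth_cube (hC : C.Basic) (hR : C.Reduces S S') (hM : C.Minimal S S')
    {Γ : DTree S C.ext} (hΓ : Γ.Solves C) {h : ℕ}
    (hh : h ≤ maxLen (C.inner S') ^ 2 * betaPlus C S') : h ≤ minDepth C S ^ 3 := by
  -- `Γ` shows that solving trees exist, so the infimum is attained.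
  obtain ⟨Γ₀, h1, h2⟩ := Nat.sInf_mem
    (s := {h : ℕ | ∃ Γ : DTree S C.ext, Γ.Solves C ∧ Γ.depth = h}) ⟨_, Γ, hΓ, rfl⟩
  have h3 := (maxLen_mono (C.inner_subset S')).trans (maxLen_le_depth hC hR hM h1)
  have h4 := betaPlus_le_depth hC hR h1
  rw [h2] at h3 h4
  exact hh.trans ((Nat.mul_le_mul (Nat.pow_le_pow_left h3 2) h4).trans (by rw [pow_succ _ 2]; rfl))

end lower

/-! ## Written rules and rules -/

/-- The written rule `p` is a notation for the rule `r`. -/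
def Rep (p : WRule) (r : Rule) : Prop := p.1.Nodup ∧ p.1.toFinset = r.lhs ∧ p.2 = r.rhs

/-- The list `w` consists of notations for the rules of `T`, possibly with repetitions. -/
def Lists (w : List WRule) (T : Finset Rule) : Prop :=
  (∀ p ∈ w, ∃ r ∈ T, Rep p r) ∧ ∀ r ∈ T, ∃ p ∈ w, Rep p r

theorem Rep.unique {p : WRule} {r r' : Rule} (h : Rep p r) (h' : Rep p r') : r = r' :=
  Rule.ext (h.2.1.symm.trans h'.2.1) (h.2.2.symm.trans h'.2.2)

theorem Rep.mem_iff {p : WRule} {r : Rule} (h : Rep p r) {e : ℕ × ℕ} : e ∈ p.1 ↔ e ∈ r.lhs := by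
  rw [← h.2.1, List.mem_toFinset]

theorem Rep.length_eq {p : WRule} {r : Rule} (h : Rep p r) : p.1.length = r.length := by
  rw [Rule.length, ← h.2.1, List.toFinset_card_of_nodup h.1]

theorem Rep.isEmpty_iff {p : WRule} {r : Rule} (h : Rep p r) : p.1.isEmpty ↔ r.length = 0 := by
  rw [← h.length_eq, List.isEmpty_iff, List.length_eq_zero_iff]

theorem Rep.toFinset_attrs {p : WRule} {r : Rule} (h : Rep p r) :
    (p.1.map fun e => e.1).toFinset = r.attrs := by
  rw [Rule.attrs, ← h.2.1]
  ext a
  simp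

theorem Rep.nodup_attrs {p : WRule} {r : Rule} (h : Rep p r) : (p.1.map fun e => e.1).Nodup :=
  h.1.map_on fun e he e' he' => r.distinct e (h.mem_iff.1 he) e' (h.mem_iff.1 he')

theorem Lists.filter {w : List WRule} {T : Finset Rule} (h : Lists w T) {f : WRule → Bool}
    {P : Rule → Prop} [DecidablePred P]
    (hf : ∀ p ∈ w, ∀ r ∈ T, Rep p r → (f p = true ↔ P r)) : Lists (w.filter f) (T.filter P) := by
  constructor
  · intro p hp
    rw [List.mem_filter] at hp
    obtain ⟨r, hr, hpr⟩ := h.1 p hp.1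
    exact ⟨r, Finset.mem_filter.2 ⟨hr, (hf p hp.1 r hr hpr).1 hp.2⟩, hpr⟩
  · intro r hr
    rw [Finset.mem_filter] at hr
    obtain ⟨p, hp, hpr⟩ := h.2 r hr.1
    exact ⟨p, List.mem_filter.2 ⟨hp, (hf p hp r hr.1 hpr).2 hr.2⟩, hpr⟩

theorem Lists.map {w : List WRule} {T : Finset Rule} (h : Lists w T) {f : WRule → WRule}
    {g : Rule → Rule} (hf : ∀ p r, Rep p r → Rep (f p) (g r)) : Lists (w.map f) (T.image g) := by
  constructor
  · intro p hp
    obtain ⟨p, hp', rfl⟩ := List.mem_map.1 hp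
    obtain ⟨r, hr, hpr⟩ := h.1 p hp'
    exact ⟨_, Finset.mem_image_of_mem g hr, hf p r hpr⟩
  · intro r hr
    obtain ⟨r, hr', rfl⟩ := Finset.mem_image.1 hr
    obtain ⟨p, hp, hpr⟩ := h.2 r hr'
    exact ⟨_, List.mem_map_of_mem hp, hf p r hpr⟩

theorem Lists.all_iff {w : List WRule} {T : Finset Rule} (h : Lists w T) {f : WRule → Bool}
    {P : Rule → Prop} (hf : ∀ p r, Rep p r → (f p = true ↔ P r)) :
    w.all f = true ↔ ∀ r ∈ T, P r := by
  rw [List.all_eq_true]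
  constructor
  · intro h' r hr
    obtain ⟨p, hp, hpr⟩ := h.2 r hr
    exact (hf p r hpr).1 (h' p hp)
  · intro h' p hp
    obtain ⟨r, hr, hpr⟩ := h.1 p hp
    exact (hf p r hpr).2 (h' r hr)

theorem Lists.any_iff {w : List WRule} {T : Finset Rule} (h : Lists w T) {f : WRule → Bool}
    {P : Rule → Prop} (hf : ∀ p r, Rep p r → (f p = true ↔ P r)) :
    w.any f = true ↔ ∃ r ∈ T, P r := by
  rw [List.any_eq_true]
  constructor
  · rintro ⟨p, hp, hfp⟩
    obtain ⟨r, hr, hpr⟩ := h.1 p hp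
    exact ⟨r, hr, (hf p r hpr).1 hfp⟩
  · rintro ⟨r, hr, hP⟩
    obtain ⟨p, hp, hpr⟩ := h.2 r hr
    exact ⟨p, hp, (hf p r hpr).2 hP⟩

theorem Presents.lists {w : List WRule} {S : Finset Rule} (h : Presents w S) : Lists w S := by
  obtain ⟨h1, -, h3⟩ := h
  have h3' : ∀ x, x ∈ (w.map fun p => (p.1.toFinset, p.2)).toFinset ↔
    x ∈ S.image fun r => (r.lhs, r.rhs) := fun x => by rw [h3]
  simp only [List.mem_toFinset, List.mem_map, Finset.mem_image] at h3'
  constructor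
  · intro p hp
    obtain ⟨r, hr, he⟩ := (h3' (p.1.toFinset, p.2)).1 ⟨p, hp, rfl⟩
    exact ⟨r, hr, h1 p hp, (Prod.mk.inj he).1.symm, (Prod.mk.inj he).2.symm⟩
  · intro r hr
    obtain ⟨p, hp, he⟩ := (h3' (r.lhs, r.rhs)).2 ⟨r, hr, rfl⟩
    exact ⟨p, hp, h1 p hp, (Prod.mk.inj he).1, (Prod.mk.inj he).2⟩

/-- `Lists` tolerates repetitions, because different rules may become equal after restriction. A
sublist of a list without repetitions has none, so the stronger notion is recovered for the output.
-/
theorem Lists.presents {w w' : List WRule} {S T : Finset Rule} (h : Presents w S)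
    (hw : w'.Sublist w) (hT : Lists w' T) : Presents w' T := by
  refine ⟨fun p hp => h.1 p (hw.subset hp), (hw.map _).nodup h.2.1, ?_⟩
  ext ⟨l, n⟩
  simp only [List.mem_toFinset, List.mem_map, Finset.mem_image, Prod.mk.injEq]
  constructor
  · rintro ⟨p, hp, rfl, rfl⟩
    obtain ⟨r, hr, hpr⟩ := hT.1 p hp
    exact ⟨r, hr, hpr.2.1.symm, hpr.2.2.symm⟩
  · rintro ⟨r, hr, rfl, rfl⟩
    obtain ⟨p, hp, hpr⟩ := hT.2 r hr
    exact ⟨p, hp, hpr.2.1, hpr.2.2⟩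

/-! ## The list functions represent the operations on rule systems -/

theorem any_decide_eq {β : Type} [DecidableEq β] (l : List β) (b : β) :
    (l.any fun x => decide (x = b)) = true ↔ b ∈ l := by
  simp

theorem consistentL_iff {p : WRule} {r : Rule} (h : Rep p r) {α : List Eqn} {δ : ℕ → Option ℕ}
    {Q : Finset ℕ} (hα : α.toFinset = tupleEqs δ Q) :
    consistentL p α = true ↔ Consistent (r.eqs ∪ tupleEqs δ Q) := by
  rw [consistent_union_tupleEqs, consistentL, List.all_eq_true]
  constructor
  · intro h' e he hQ
    have h1 : (e.1, δ e.1) ∈ α := by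
      rw [← List.mem_toFinset, hα]; exact mem_tupleEqs.2 ⟨hQ, rfl⟩
    simpa using List.all_eq_true.1 (h' e (h.mem_iff.2 he)) _ h1
  · intro h' e he
    rw [List.all_eq_true]
    intro q hq
    rw [← List.mem_toFinset, hα, mem_tupleEqs] at hq
    rw [Bool.or_eq_true, decide_eq_true_eq, Bool.not_eq_true', decide_eq_false_iff_not]
    by_cases he' : q.1 = e.1
    · right
      rw [← hq.2, he']
      exact h' e (h.mem_iff.1 he) (he' ▸ hq.1)
    · exact .inl he'

theorem Rep.removeL {p : WRule} {r : Rule} (h : Rep p r) (α : List Eqn) :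
    Rep (removeL α p) (r.remove α.toFinset) := by
  refine ⟨h.1.filter _, ?_, h.2.2⟩
  ext e
  simp only [DecisionRules.removeL, Rule.remove, List.mem_toFinset, List.mem_filter, h.mem_iff,
    Finset.mem_filter, Bool.not_eq_true', ← Bool.not_eq_true, any_decide_eq]

theorem Lists.restrictL {w : List WRule} {T : Finset Rule} (h : Lists w T) {α : List Eqn}
    {δ : ℕ → Option ℕ} {Q : Finset ℕ} (hα : α.toFinset = tupleEqs δ Q) :
    Lists (restrictL w α) (restrict T (tupleEqs δ Q)) := by
  refine (h.filter fun p _ r _ hpr => consistentL_iff hpr hα).map fun p r hpr => ?_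
  rw [← hα]
  exact hpr.removeL α

theorem lengthLE_iff {β : Type} (l l' : List β) : lengthLE l l' = true ↔ l.length ≤ l'.length := by
  have : ∀ l' l : List β, l'.foldl (fun b _ => b.tail) l = l.drop l'.length := by
    intro l'
    induction l' with
    | nil => simp
    | cons a l' ih => intro l; rw [List.foldl_cons, ih]; simp
  rw [lengthLE, this, List.isEmpty_iff, List.drop_eq_nil_iff]

theorem length_eq_maxLen_iff {T : Finset Rule} {r : Rule} (hr : r ∈ T) :
    r.length = maxLen T ↔ ∀ r' ∈ T, r'.length ≤ r.length := by
  constructor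
  · intro h r' hr'
    rw [h]
    exact length_le_maxLen hr'
  · exact fun h => (length_le_maxLen hr).antisymm (Finset.sup_le h)

theorem Lists.plusL {w : List WRule} {T : Finset Rule} (h : Lists w T) :
    Lists (plusL w) (plus T) := by
  refine h.filter fun p _ r hr hpr => ?_
  rw [length_eq_maxLen_iff hr]
  exact h.all_iff fun p' r' h' => by rw [lengthLE_iff, hpr.length_eq, h'.length_eq]

theorem Lists.innerSRL {w : List WRule} {T : Finset Rule} (h : Lists w T) :
    Lists (innerSRL w) (innerSR T) := by
  have h1 := h.any_iff (f := fun p => p.1.isEmpty) fun p r => Rep.isEmpty_iff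
  rw [DecisionRules.innerSRL, innerSR]
  split_ifs with h2
  · have : (w.any fun p => p.1.isEmpty) = false := by
      rw [← Bool.not_eq_true, h1]
      rintro ⟨r, hr, h0⟩
      exact h2 r hr h0
    rw [this]
    exact h
  · push Not at h2
    rw [h1.2 h2]
    exact h.filter fun p _ r _ => Rep.isEmpty_iff

theorem Lists.innerADL {w : List WRule} {T : Finset Rule} (h : Lists w T) :
    Lists (innerADL w) (innerAD T) := by
  refine h.filter fun p _ r _ hpr => ?_
  rw [Bool.or_eq_true, hpr.isEmpty_iff]
  refine or_congr_right (h.all_iff fun p' r' h' => ?_)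
  rw [Bool.or_eq_true, Bool.not_eq_true', ← Bool.not_eq_true, h'.isEmpty_iff, h'.2.2, hpr.2.2]
  simp only [Bool.not_eq_true', decide_eq_false_iff_not]
  tauto

theorem subsetL_iff {p p' : WRule} {r r' : Rule} (h : Rep p r) (h' : Rep p' r') :
    subsetL p.1 p'.1 = true ↔ r.lhs ⊆ r'.lhs := by
  rw [subsetL, List.all_eq_true]
  simp only [any_decide_eq, h.mem_iff, h'.mem_iff]
  rfl

theorem not_ssubsetL_iff {p p' : WRule} {r r' : Rule} (h : Rep p r) (h' : Rep p' r') :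
    (!(subsetL p.1 p'.1 && !subsetL p'.1 p.1)) = true ↔ ¬ r.lhs ⊂ r'.lhs := by
  rw [Bool.not_eq_true', ← Bool.not_eq_true, Bool.and_eq_true, Bool.not_eq_true',
    ← Bool.not_eq_true, subsetL_iff h h', subsetL_iff h' h]
  rfl

theorem Lists.reduceSRL {w : List WRule} {T : Finset Rule} (h : Lists w T) :
    Lists (reduceSRL w) (reduceSR T) :=
  h.filter fun _ _ _ _ hpr => h.all_iff fun _ _ h' => not_ssubsetL_iff h' hpr

theorem Lists.reduceADL {w : List WRule} {T : Finset Rule} (h : Lists w T) :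
    Lists (reduceADL w) (reduceAD T) := by
  refine h.filter fun p _ r _ hpr => h.all_iff fun p' r' h' => ?_
  rw [Bool.or_eq_true, not_ssubsetL_iff h' hpr, Bool.not_eq_true', decide_eq_false_iff_not,
    h'.2.2, hpr.2.2, imp_iff_not_or]

theorem disjointL_iff {p p' : WRule} {r r' : Rule} (h : Rep p r) (h' : Rep p' r') :
    disjointL p p' = true ↔ r.attrs ∩ r'.attrs = ∅ := by
  rw [← Finset.disjoint_iff_inter_eq_empty, Finset.disjoint_left, disjointL, List.all_eq_true]
  simp only [List.all_eq_true, Bool.not_eq_true', decide_eq_false_iff_not, h.mem_iff, h'.mem_iff,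
    Rule.mem_attrs]
  constructor
  · rintro h1 a ⟨v, hv⟩ ⟨v', hv'⟩
    exact h1 _ hv _ hv' rfl
  · rintro h1 ⟨a, v⟩ hv ⟨a', v'⟩ hv' (rfl : a = a')
    exact h1 ⟨v, hv⟩ ⟨v', hv'⟩

/-- The attributes of the rules of a list. -/
def attrsL (ch : List WRule) : List ℕ := (ch.map fun r => r.1.map fun e => e.1).flatten

/-- One pass simulates repeated removal: with `ch` already chosen, the rules not yet removed are
those disjoint from all of `ch`. Nonempty attribute sets are needed so that a chosen rule removes
itself. -/
theorem exists_greedy_fold (w : List WRule) (hw : ∀ p ∈ w, ∃ r : Rule, Rep p r ∧ r.attrs.Nonempty) :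
    ∀ ch : List WRule, (∀ p ∈ ch, ∃ r : Rule, Rep p r) → ∃ new : List WRule,
      w.foldl (fun ch r => bif ch.all fun r' => disjointL r r' then r :: ch else ch) ch =
        new ++ ch ∧ ((attrsL ch).Nodup → (attrsL (new ++ ch)).Nodup) ∧
      ∀ T, Lists (w.filter fun r => ch.all fun r' => disjointL r r') T →
        GreedyCover T (attrsL new).toFinset := by
  induction w with
  | nil =>
    refine fun ch _ => ⟨[], rfl, id, fun T hT => ?_⟩
    have : T = ∅ := Finset.eq_empty_of_forall_notMem fun r hr => by
      obtain ⟨p, hp, -⟩ := hT.2 r hr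
      simp at hp
    rw [this]
    exact .done
  | cons p w ih =>
    intro ch hch
    obtain ⟨r, hpr, hne⟩ := hw p (by simp)
    have ih := ih fun p hp => hw p (by simp [hp])
    rw [List.foldl_cons]
    cases hd : ch.all fun r' => disjointL p r'
    · obtain ⟨new, h1, h2, h3⟩ := ih ch hch
      refine ⟨new, h1, h2, fun T hT => h3 T ?_⟩
      rwa [List.filter_cons_of_neg (by simp [hd])] at hT
    · obtain ⟨new, h1, h2, h3⟩ := ih (p :: ch) (by
        intro p' hp'
        rcases List.mem_cons.1 hp' with rfl | hp'
        · exact ⟨r, hpr⟩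
        · exact hch p' hp')
      refine ⟨new ++ [p], ?_, fun hnd => ?_, fun T hT => ?_⟩
      · rw [cond_true, h1]; simp
      · rw [List.append_assoc]
        refine h2 ?_
        rw [attrsL, List.map_cons, List.flatten_cons, List.nodup_append]
        refine ⟨hpr.nodup_attrs, hnd, ?_⟩
        rintro a ha b hb rfl
        obtain ⟨l, hl, hal⟩ := List.mem_flatten.1 hb
        obtain ⟨p', hp', rfl⟩ := List.mem_map.1 hl
        obtain ⟨r', hpr'⟩ := hch p' hp'
        have hdis := (disjointL_iff hpr hpr').1 (List.all_eq_true.1 hd p' hp')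
        rw [← hpr.toFinset_attrs, ← hpr'.toFinset_attrs] at hdis
        have : a ∈ (∅ : Finset ℕ) := by
          rw [← hdis, Finset.mem_inter, List.mem_toFinset, List.mem_toFinset]
          exact ⟨ha, hal⟩
        simp at this
      · rw [List.filter_cons, if_pos hd] at hT
        have hrT : r ∈ T := by
          obtain ⟨r', hr', h'⟩ := hT.1 p (by simp)
          rwa [hpr.unique h']
        have hset : (attrsL (new ++ [p])).toFinset = r.attrs ∪ (attrsL new).toFinset := by
          rw [Finset.union_comm, ← hpr.toFinset_attrs]
          simp [attrsL]
        rw [hset]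
        refine .step T r _ hrT (h3 _ ?_)
        have h4 := hT.filter (f := fun p' => disjointL p' p)
          (P := fun r' => r.attrs ∩ r'.attrs = ∅) fun p' _ r' _ h' => by
            rw [disjointL_iff h' hpr, Finset.inter_comm]
        -- The chosen rule meets itself, so it leaves the list of remaining rules.
        have h5 : disjointL p p = false := by
          rw [← Bool.not_eq_true, disjointL_iff hpr hpr, Finset.inter_self]
          exact hne.ne_empty
        rw [List.filter_cons_of_neg (by simp [h5]), List.filter_filter] at h4
        exact h4

theorem greedyCover_coverL {w : List WRule} {T : Finset Rule} (h : Lists w T)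
    (hne : ∀ r ∈ T, r.attrs.Nonempty) :
    (coverL w).Nodup ∧ GreedyCover T (coverL w).toFinset := by
  obtain ⟨new, h1, h2, h3⟩ := exists_greedy_fold w (fun p hp => by
    obtain ⟨r, hr, hpr⟩ := h.1 p hp
    exact ⟨r, hpr, hne r hr⟩) [] (by simp)
  have h4 : coverL w = attrsL new := by
    rw [coverL, greedyL, h1, List.append_nil, attrsL]
  rw [h4]
  refine ⟨by simpa [attrsL] using h2, h3 T ?_⟩
  simpa using h

/-! ## The decision tree of the algorithm -/

section tree

variable {C : Problem} {I : List WRule → List WRule} {w : List WRule} {S S' : Finset Rule}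

theorem adaptL_eq (hw : Lists w S') (δ : ℕ → Option ℕ) (a : ℕ) :
    adaptL w (a, δ a) = (a, adapt S' δ a) := by
  have h : (w.any fun r => r.1.any fun e => decide ((e.1, some e.2) = (a, δ a))) = true ↔
      ∃ r ∈ S', ∃ e ∈ r.lhs, (e.1, some e.2) = (a, δ a) := hw.any_iff fun p r hpr => by
    rw [List.any_eq_true]
    simp only [decide_eq_true_eq, hpr.mem_iff]
  rw [adaptL, adapt]
  congr 1
  split_ifs with hv
  · rcases mem_values.1 hv with ⟨n, hn, r, hr, he⟩ | ⟨-, hn⟩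
    · rw [h.2 ⟨r, hr, (a, n), he, by rw [hn]⟩]; rfl
    · simp [hn]
  · have : (w.any fun r => r.1.any fun e => decide ((e.1, some e.2) = (a, δ a))) = false := by
      rw [← Bool.not_eq_true, h]
      rintro ⟨r, hr, ⟨a', n⟩, he, heq⟩
      simp only [Prod.mk.injEq] at heq
      obtain ⟨rfl, heq⟩ := heq
      exact hv (mem_values.2 (.inl ⟨n, heq.symm, r, hr, he⟩))
    rw [this]; rfl

theorem adapt_eq_some_iff {δ : ℕ → Option ℕ} {r : Rule} (hr : r ∈ S') {e : ℕ × ℕ}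
    (he : e ∈ r.lhs) : adapt S' δ e.1 = some e.2 ↔ δ e.1 = some e.2 := by
  rw [adapt]
  constructor
  · intro h
    split_ifs at h with h1
    exact h
  · intro h
    rw [if_pos, h]
    exact mem_values.2 (.inl ⟨e.2, h, r, hr, he⟩)

theorem adapt_mem_values {ext : Bool} (hext : ext = true ∨ S' = S) {δ : ℕ → Option ℕ}
    (hδ : IsTuple S ext δ) {a : ℕ} (ha : a ∈ attributes S') :
    adapt S' δ a ∈ values S' ext a := by
  rcases hext with rfl | rfl
  · rw [adapt]
    split_ifs with h
    · exact h
    · exact mem_values.2 (.inr ⟨rfl, rfl⟩)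
  · have h := hδ a ha
    rw [adapt, if_pos]
    · exact h
    · rw [mem_values] at h ⊢
      exact h.imp id fun h => ⟨rfl, h.2⟩

theorem toFinset_map_adaptL (hw : Lists w S') {δ δ' : ℕ → Option ℕ} {s : List ℕ}
    (h : ∀ a ∈ s, δ' a = adapt S' δ a) :
    ((s.map fun a => (a, δ a)).map fun p => adaptL w p).toFinset = tupleEqs δ' s.toFinset := by
  ext ⟨a, v⟩
  simp only [List.map_map, List.mem_toFinset, List.mem_map, mem_tupleEqs, Function.comp,
    adaptL_eq hw, Prod.mk.injEq]
  constructor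
  · rintro ⟨a, ha, rfl, rfl⟩
    exact ⟨ha, h a ha⟩
  · rintro ⟨ha, rfl⟩
    exact ⟨a, ha, rfl, (h a ha).symm⟩

theorem toFinset_map_eq (δ : ℕ → Option ℕ) (s : List ℕ) :
    (s.map fun a => (a, δ a)).toFinset = tupleEqs δ s.toFinset := by
  ext ⟨a, v⟩
  simp only [List.mem_toFinset, List.mem_map, mem_tupleEqs, Prod.mk.injEq]
  constructor
  · rintro ⟨a, ha, rfl, rfl⟩
    exact ⟨ha, rfl⟩
  · rintro ⟨ha, rfl⟩
    exact ⟨a, ha, rfl, rfl⟩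

/-- The attributes of the next round in the increasing order. -/
def roundL (I : List WRule → List WRule) (w : List WRule) (S : Finset Rule) (ξ : List Eqn) :
    List ℕ := ((attributes S).sort (· ≤ ·)).filter fun a => pickL I w ξ a

theorem lists_stateL (hI : ∀ w T, Lists w T → Lists (I w) (C.inner T)) (hw : Lists w S')
    {ξ : List Eqn} {δ : ℕ → Option ℕ} {Q : Finset ℕ}
    (hξ : (ξ.map fun p => adaptL w p).toFinset = tupleEqs δ Q) :
    Lists (stateL I w ξ) (C.inner (restrict S' (tupleEqs δ Q))) :=
  hI _ _ (hw.restrictL hξ)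

theorem doneL_iff (hI : ∀ w T, Lists w T → Lists (I w) (C.inner T)) (hw : Lists w S')
    {ξ : List Eqn} {δ : ℕ → Option ℕ} {Q : Finset ℕ}
    (hξ : (ξ.map fun p => adaptL w p).toFinset = tupleEqs δ Q) :
    doneL I w ξ = true ↔ ∀ r ∈ C.inner (restrict S' (tupleEqs δ Q)), r.length = 0 :=
  (lists_stateL hI hw hξ).all_iff fun _ _ => Rep.isEmpty_iff

/-- Before the end the maximum length is positive, so the longest rules have attributes and a greedy
cover exists. The attributes on which `Q` has been computed were removed from all rules, so a round
never repeats a query. -/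
theorem greedyCover_roundL (hI : ∀ w T, Lists w T → Lists (I w) (C.inner T)) (hw : Lists w S')
    {ξ : List Eqn} {δ : ℕ → Option ℕ} {Q : Finset ℕ}
    (hξ : (ξ.map fun p => adaptL w p).toFinset = tupleEqs δ Q)
    (hS : S' ⊆ S) (hd : doneL I w ξ = false) :
    (roundL I w S ξ).Nodup ∧ (∀ a ∈ roundL I w S ξ, a ∈ attributes S' ∧ a ∉ Q) ∧
      GreedyCover (plus (C.inner (restrict S' (tupleEqs δ Q)))) (roundL I w S ξ).toFinset := by
  have hl := lists_stateL hI hw hξ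
  have hn := mt (doneL_iff hI hw hξ).2 (by simp [hd])
  push Not at hn
  obtain ⟨r, hr, h0⟩ := hn
  have hpos := (Nat.pos_of_ne_zero h0).trans_le (length_le_maxLen hr)
  obtain ⟨-, h2⟩ := greedyCover_coverL hl.plusL fun r hr => by
    rw [← Finset.card_pos, Rule.card_attrs, (Finset.mem_filter.1 hr).2]
    exact hpos
  have h3 : ∀ a ∈ (coverL (plusL (stateL I w ξ))).toFinset, a ∈ attributes S' ∧ a ∉ Q := by
    intro a ha
    obtain ⟨r, hr, har⟩ := Finset.mem_biUnion.1 (h2.isNodeCover.1 ha)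
    obtain ⟨r, hr', hc, rfl⟩ := mem_restrict.1 (C.inner_subset _ (Finset.mem_filter.1 hr).1)
    rw [Rule.attrs_remove hc, Finset.mem_sdiff] at har
    exact ⟨attrs_subset_attributes hr' har.1, har.2⟩
  have h4 : (roundL I w S ξ).toFinset = (coverL (plusL (stateL I w ξ))).toFinset := by
    ext a
    simp only [roundL, pickL, List.mem_toFinset, List.mem_filter, any_decide_eq,
      Finset.mem_sort]
    refine and_iff_right_of_imp fun h => attributes_mono hS (h3 a (List.mem_toFinset.2 h)).1
  refine ⟨(Finset.sort_nodup _ _).filter _, fun a ha => h3 a ?_, h4 ▸ h2⟩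
  rwa [← h4, List.mem_toFinset]

theorem stepL_map (δ : ℕ → Option ℕ) (ξ : List Eqn) : stepL I w (tupleList S δ) ξ =
    bif doneL I w ξ then ξ else ξ ++ (roundL I w S ξ).map fun a => (a, δ a) := by
  rw [stepL, roundL, tupleList, List.filter_map]
  rfl

/-- Induction on a bound for the maximum length, which every unfinished round lowers. Once the work
is finished, the state is a fixed point of `stepL` and the remaining iterations are idle. -/
theorem exists_rounds (hC : C.Basic) (hI : ∀ w T, Lists w T → Lists (I w) (C.inner T))
    (hw : Lists w S') (hS : S' ⊆ S) {δ δ' : ℕ → Option ℕ}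
    (hδ' : ∀ a ∈ attributes S', δ' a = adapt S' δ a) (n : ℕ) : ∀ s : List ℕ,
    (∀ a ∈ s, a ∈ attributes S') →
    maxLen (C.inner (restrict S' (tupleEqs δ' s.toFinset))) ≤ n →
    ∃ s' : List ℕ, (stepL I w (tupleList S δ))^[n] (s.map fun a => (a, δ a)) =
      (s ++ s').map (fun a => (a, δ a)) ∧ Rounds C.inner S' δ' s.toFinset s' ∧
      ∀ a ∈ s', a ∈ attributes S' := by
  induction n with
  | zero =>
    intro s _ hm
    exact ⟨[], by simp, .finish _ fun r hr =>
      Nat.le_zero.1 ((length_le_maxLen hr).trans hm), by simp⟩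
  | succ n ih =>
    intro s hs hm
    have hξ := toFinset_map_adaptL hw fun a ha => hδ' a (hs a ha)
    rw [Function.iterate_succ_apply, stepL_map]
    cases hd : doneL I w (s.map fun a => (a, δ a))
    · obtain ⟨h1, h2, h3⟩ := greedyCover_roundL hI hw hξ hS hd
      have hn := mt (doneL_iff hI hw hξ).2 (by simp [hd])
      set b := roundL I w S (s.map fun a => (a, δ a)) with hb
      have hlt := maxLen_inner_lt hC hn h3.isNodeCover
      rw [← List.toFinset_append] at hlt
      obtain ⟨s', h4, h5, h6⟩ := ih (s ++ b) (fun a ha => by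
        rcases List.mem_append.1 ha with ha | ha
        · exact hs a ha
        · exact (h2 a ha).1) (by omega)
      refine ⟨b ++ s', ?_, .round _ b s' hn h1 h3 (by rwa [← List.toFinset_append]),
        fun a ha => ?_⟩
      · rw [cond_false, ← List.map_append, h4, List.append_assoc]
      · rcases List.mem_append.1 ha with ha | ha
        · exact (h2 a ha).1
        · exact h6 a ha
    · refine ⟨[], ?_, .finish _ ((doneL_iff hI hw hξ).1 hd), by simp⟩
      rw [cond_true, List.append_nil]
      exact Function.iterate_fixed (by rw [stepL_map, hd, cond_true]) n

variable {ext : Bool}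

/-- The tree that computes the values of the listed attributes and continues with `k`. -/
def queryTree (k : List Eqn → DTree S ext) : List ℕ → List Eqn → DTree S ext
  | [], ξ => k ξ
  -- The test only supplies the proof that a node requires; rounds contain no attribute outside
  -- `A(S)`.
  | a :: b, ξ => if ha : a ∈ attributes S then
      .node a ha fun v => queryTree k b (ξ ++ [(a, v.1)]) else queryTree k b ξ

/-- The tree that makes at most `n` rounds, when the equations `ξ` have been computed. -/
def roundsTree (I : List WRule → List WRule) (w : List WRule) (ext : Bool) (hS : S' ⊆ S) :
    ℕ → List Eqn → DTree S ext
  | 0, ξ => .leaf (S'.filter fun r => r.eqs ⊆ ξ.toFinset) ((Finset.filter_subset _ _).trans hS)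
  | n + 1, ξ => bif doneL I w ξ then
      .leaf (S'.filter fun r => r.eqs ⊆ ξ.toFinset) ((Finset.filter_subset _ _).trans hS) else
      queryTree (roundsTree I w ext hS n) (roundL I w S ξ) ξ

theorem isPath_queryTree {k : List Eqn → DTree S ext} {δ : ℕ → Option ℕ} (hδ : IsTuple S ext δ)
    {η : List Eqn} {τ : Finset Rule} (b : List ℕ) : ∀ ξ : List Eqn,
    (∀ a ∈ b, a ∈ attributes S) → (k (ξ ++ b.map fun a => (a, δ a))).IsPath η τ →
    (queryTree k b ξ).IsPath ((b.map fun a => (a, δ a)) ++ η) τ := by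
  induction b with
  | nil => intro ξ _ h; simpa [queryTree] using h
  | cons a b ih =>
    intro ξ hb h
    have ha := hb a (by simp)
    rw [queryTree, dif_pos ha]
    exact .node a ha _ ⟨δ a, hδ a ha⟩ _ τ
      (ih _ (fun a ha => hb a (by simp [ha])) (by simpa using h))

theorem isPath_roundsTree (hS : S' ⊆ S) {δ : ℕ → Option ℕ} (hδ : IsTuple S ext δ) (n : ℕ) :
    ∀ ξ : List Eqn, ∃ η : List Eqn, (stepL I w (tupleList S δ))^[n] ξ = ξ ++ η ∧
      (roundsTree I w ext hS n ξ).IsPath η (S'.filter fun r => r.eqs ⊆ (ξ ++ η).toFinset) := by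
  induction n with
  | zero => exact fun ξ => ⟨[], by simp, by simpa using .leaf _ _⟩
  | succ n ih =>
    intro ξ
    rw [Function.iterate_succ_apply, stepL_map, roundsTree]
    cases hd : doneL I w ξ
    · obtain ⟨η, h1, h2⟩ := ih (ξ ++ (roundL I w S ξ).map fun a => (a, δ a))
      refine ⟨((roundL I w S ξ).map fun a => (a, δ a)) ++ η, ?_, ?_⟩
      · rw [cond_false, h1, List.append_assoc]
      · rw [cond_false, ← List.append_assoc]
        refine isPath_queryTree hδ _ ξ (fun a ha => ?_) h2
        rw [roundL, List.mem_filter, Finset.mem_sort] at ha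
        exact ha.1
    · refine ⟨[], ?_, by simpa using .leaf _ _⟩
      rw [cond_true, List.append_nil]
      exact Function.iterate_fixed (by rw [stepL_map, hd, cond_true]) n

/-- The depth also counts inconsistent paths. As no attribute is repeated, every branch here is the
beginning of the path of some tuple, so bounding `k` on tuples suffices. -/
theorem depth_queryTree {k : List Eqn → DTree S ext} {D : ℕ} (b : List ℕ) :
    ∀ (s : List ℕ) (δ : ℕ → Option ℕ), IsTuple S ext δ → b.Nodup →
    (∀ a ∈ b, a ∈ attributes S) → (∀ a ∈ b, a ∉ s) →
    (∀ δ₁, IsTuple S ext δ₁ → (∀ a ∈ s, δ₁ a = δ a) →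
      (k ((s ++ b).map fun a => (a, δ₁ a))).depth ≤ D) →
    (queryTree k b (s.map fun a => (a, δ a))).depth ≤ b.length + D := by
  induction b with
  | nil =>
    intro s δ hδ _ _ _ h
    simpa [queryTree] using h δ hδ fun _ _ => rfl
  | cons a b ih =>
    intro s δ hδ hnd hb hs h
    rw [List.nodup_cons] at hnd
    have key : ∀ δ₂ : ℕ → Option ℕ, IsTuple S ext δ₂ → (∀ a ∈ s, δ₂ a = δ a) →
        (queryTree k b ((s ++ [a]).map fun a => (a, δ₂ a))).depth ≤ b.length + D := by
      intro δ₂ hδ₂ hag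
      refine ih (s ++ [a]) δ₂ hδ₂ hnd.2 (fun a' ha' => hb a' (by simp [ha'])) (fun a' ha' => ?_) fun δ₁ hδ₁ h1 => ?_
      · rw [List.mem_append, List.mem_singleton, not_or]
        exact ⟨hs a' (by simp [ha']), fun h => hnd.1 (h ▸ ha')⟩
      · rw [List.append_assoc, List.singleton_append]
        exact h δ₁ hδ₁ fun a ha => (h1 a (by simp [ha])).trans (hag a ha)
    rw [queryTree, dif_pos (hb a (by simp)), DTree.depth, List.length_cons, Nat.add_right_comm]
    refine Nat.succ_le_succ (Finset.sup_le fun v _ => ?_)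
    -- The branch with value `v` is followed by the tuple changed at `a`, which is a new attribute,
    -- so the earlier equations persist.
    have hupd : ∀ a' ∈ s, Function.update δ a v.1 a' = δ a' := fun a' ha' =>
      Function.update_of_ne (fun he => hs a (by simp) (by rwa [he] at ha')) _ _
    have := key (Function.update δ a v.1) (fun a' ha' => by
      by_cases he : a' = a
      · subst he; rw [Function.update_self]; exact v.2
      · rw [Function.update_of_ne he]; exact hδ a' ha') hupd
    rw [List.map_append, List.map_congr_left (g := fun a => (a, δ a)) fun a' ha' => by
      rw [hupd a' ha']] at this
    simpa using this

/-- Here `m` bounds the current maximum length and hence the remaining rounds, while `D` stays fixed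
at a bound for the greedy factor. The fuel `n` does not enter the bound. -/
theorem depth_roundsTree (hC : C.Basic) (hI : ∀ w T, Lists w T → Lists (I w) (C.inner T))
    (hw : Lists w S') (hS : S' ⊆ S) (hext : C.ext = true ∨ S' = S) (D : ℕ) (n : ℕ) :
    ∀ (m : ℕ) (s : List ℕ) (δ : ℕ → Option ℕ), IsTuple S C.ext δ →
    (∀ a ∈ s, a ∈ attributes S') → m ≤ D →
    maxLen (C.inner (restrict S' (tupleEqs (adapt S' δ) s.toFinset))) ≤ m →
    (roundsTree I w C.ext hS n (s.map fun a => (a, δ a))).depth ≤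
      m * (betaPlus C S' * D) := by
  induction n with
  | zero => intro m s δ _ _ _ _; simp [roundsTree, DTree.depth]
  | succ n ih =>
    intro m s δ hδ hs hmD hm
    have hξ := toFinset_map_adaptL hw (δ := δ) (s := s) fun a _ => rfl
    rw [roundsTree]
    cases hd : doneL I w (s.map fun a => (a, δ a))
    · obtain ⟨h1, h2, h3⟩ := greedyCover_roundL hI hw hξ hS hd
      have hn := mt (doneL_iff hI hw hξ).2 (by simp [hd])
      set b := roundL I w S (s.map fun a => (a, δ a)) with hb
      have hlt := maxLen_inner_lt hC hn h3.isNodeCover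
      -- The strict decrease `hlt` forces `m` to be positive.
      obtain ⟨m, rfl⟩ : ∃ m', m = m' + 1 := ⟨m - 1, by omega⟩
      have hβ : coverNumber (plus (C.inner (restrict S' (tupleEqs (adapt S' δ) s.toFinset)))) ≤
          betaPlus C S' :=
        Finset.le_sup (f := fun α => coverNumber (plus (C.inner (restrict S' α))))
          (mem_eqSystems.2 ⟨fun p hp => by
            rw [mem_tupleEqs, List.mem_toFinset] at hp
            refine ⟨hs _ hp.1, ?_⟩
            rw [← hp.2]
            exact adapt_mem_values hext hδ (hs _ hp.1), consistent_tupleEqs _ _⟩)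
      have hlen : b.length ≤ betaPlus C S' * D := by
        rw [← List.toFinset_card_of_nodup h1]
        exact h3.card_le_coverNumber.trans (Nat.mul_le_mul hβ (hm.trans hmD))
      rw [cond_false, Nat.succ_mul, Nat.add_comm]
      refine (depth_queryTree b s δ hδ h1 (fun a ha => attributes_mono hS (h2 a ha).1) (fun a ha has => (h2 a ha).2 (by simpa using has))
        (D := m * (betaPlus C S' * D)) fun δ₁ hδ₁ hag => ?_).trans
          (Nat.add_le_add_right hlen _)
      refine ih m (s ++ b) δ₁ hδ₁ (fun a ha => ?_) (by omega) ?_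
      · rcases List.mem_append.1 ha with ha | ha
        · exact hs a ha
        · exact (h2 a ha).1
      · have heq : tupleEqs (adapt S' δ₁) s.toFinset = tupleEqs (adapt S' δ) s.toFinset :=
          Finset.image_congr fun a ha => by
            rw [Finset.mem_coe, List.mem_toFinset] at ha
            simp only [adapt, hag a ha]
        rw [← heq] at hn
        have h4 : IsNodeCover (plus (C.inner (restrict S' (tupleEqs (adapt S' δ₁) s.toFinset))))
            b.toFinset := by rw [heq]; exact h3.isNodeCover
        have h5 := maxLen_inner_lt hC hn h4
        rw [heq, ← List.toFinset_append] at h5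
        omega
    · simp [DTree.depth]

theorem Lists.resultL (hw : Lists w S') (ξ : List Eqn) :
    Lists (resultL w ξ) (S'.filter fun r => r.eqs ⊆ ξ.toFinset) := by
  refine hw.filter fun p _ r _ hpr => ?_
  rw [List.all_eq_true]
  simp only [any_decide_eq, hpr.mem_iff]
  constructor
  · intro h e he
    obtain ⟨v, h1, h2⟩ := Rule.mem_eqs.1 he
    have := h _ h2
    simp only [← h1] at this
    exact List.mem_toFinset.2 this
  · intro h e he
    exact List.mem_toFinset.1 (h (Rule.mem_eqs.2 ⟨e.2, rfl, he⟩))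

/-- Adaptation changes only values that occur in no equation of `S'` for the attribute concerned, so
it does not affect which rules of `S'` agree with the tuple. -/
theorem eqs_subset_adapt {δ δ' : ℕ → Option ℕ} (hδ' : ∀ a ∈ attributes S', δ' a = adapt S' δ a)
    {r : Rule} (hr : r ∈ S') (Q : Finset ℕ) :
    (∀ e ∈ r.lhs, e.1 ∈ Q → δ' e.1 = some e.2) ↔ ∀ e ∈ r.lhs, e.1 ∈ Q → δ e.1 = some e.2 := by
  refine forall₂_congr fun e he => ?_
  rw [hδ' e.1 (attrs_subset_attributes hr (Rule.mem_attrs.2 ⟨e.2, he⟩)), adapt_eq_some_iff hr he]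

/-- The tree described by the algorithm. -/
theorem exists_tree (hC : C.Basic) {R : List WRule → List WRule}
    (hI : ∀ w T, Lists w T → Lists (I w) (C.inner T)) (hw : Presents w S)
    (hR : Lists (R w) S') (hRw : (R w).Sublist w) (hred : C.Reduces S S')
    (hext : C.ext = true ∨ S' = S) :
    ∃ Γ : DTree S C.ext, (∀ δ, IsTuple S C.ext δ →
      ∀ δ', (∀ a ∈ attributes S', δ' a = adapt S' δ a) →
      ∃ s τ out, Γ.IsPath (s.map fun a => (a, δ a)) τ ∧ Rounds C.inner S' δ' ∅ s ∧
        (τ = S'.filter fun r => Consistent (r.eqs ∪ tupleEqs δ' s.toFinset) ∧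
          r.attrs ⊆ s.toFinset) ∧ Presents out τ ∧
        algL R I (w, tupleList S δ) = (s.map (fun a => (a, δ a)), out)) ∧
      Γ.Solves C ∧ Γ.depth ≤ maxLen (C.inner S') ^ 2 * betaPlus C S' := by
  -- Enough rounds, since no rule is longer than `|A(S)|`; it is also the number of steps made by
  -- `runL`, which folds over one entry per attribute.
  set N := (attributes S).card with hN
  have hbound : ∀ δ : ℕ → Option ℕ,
      maxLen (C.inner (restrict S' (tupleEqs δ ([] : List ℕ).toFinset))) ≤ N := by
    intro δ
    rw [List.toFinset_nil, tupleEqs_empty, restrict_empty]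
    refine Finset.sup_le fun r hr => ?_
    rw [← Rule.card_attrs]
    exact Finset.card_le_card (attrs_subset_attributes (hred.1 (C.inner_subset _ hr)))
  have hpath : ∀ δ, IsTuple S C.ext δ → ∀ δ', (∀ a ∈ attributes S', δ' a = adapt S' δ a) →
      ∃ s : List ℕ, (stepL I (R w) (tupleList S δ))^[N] [] = s.map (fun a => (a, δ a)) ∧
        Rounds C.inner S' δ' ∅ s ∧ (roundsTree I (R w) C.ext hred.1 N []).IsPath
          (s.map fun a => (a, δ a)) (S'.filter fun r => r.eqs ⊆ tupleEqs δ s.toFinset) := by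
    intro δ hδ δ' hδ'
    obtain ⟨s, h1, h2, -⟩ := exists_rounds hC hI hR hred.1 hδ' N [] (by simp) (hbound δ')
    obtain ⟨η, h3, h4⟩ := isPath_roundsTree (I := I) (w := R w) hred.1 hδ N []
    rw [List.nil_append] at h1 h3 h4
    rw [List.map_nil, h3] at h1
    subst h1
    rw [toFinset_map_eq] at h4
    exact ⟨s, h3, h2, h4⟩
  refine ⟨roundsTree I (R w) C.ext hred.1 N [], fun δ hδ δ' hδ' => ?_, ⟨rfl, fun ξ τ hξ hc => ?_⟩,
    ?_⟩
  · obtain ⟨s, h1, h2, h3⟩ := hpath δ hδ δ' hδ'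
    refine ⟨s, _, resultL (R w) (s.map fun a => (a, δ a)), h3, h2, ?_, ?_, ?_⟩
    · refine Finset.filter_congr fun r hr => ?_
      rw [eqs_subset_tupleEqs, consistent_union_tupleEqs, consistent_union_tupleEqs,
        eqs_subset_adapt hδ' hr]
    · refine Lists.presents hw (List.filter_sublist.trans hRw) ?_
      have := hR.resultL (s.map fun a => (a, δ a))
      rwa [toFinset_map_eq] at this
    · have : runL I (R w) (tupleList S δ) = s.map fun a => (a, δ a) := by
        rw [runL, List.foldl_const, tupleList, List.length_map, Finset.length_sort]
        exact h1
      rw [algL, this]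
  -- A consistent path belongs to some tuple, and a tuple has only one path, so this is a path
  -- described by the algorithm.
  · obtain ⟨δ, hδ, h1, -⟩ := exists_tuple (S := S) (ext := C.ext) hc fun p hp =>
      hξ.isEquation p (List.mem_toFinset.1 hp)
    obtain ⟨s, -, h2, h3⟩ := hpath δ hδ (adapt S' δ) fun _ _ => rfl
    obtain ⟨rfl, rfl⟩ := hξ.unique (δ := δ) h3 (fun p hp => h1 p (List.mem_toFinset.2 hp))
      fun p hp => by
        obtain ⟨a, -, rfl⟩ := List.mem_map.1 hp
        rfl
    rw [toFinset_map_eq, Problem.accepts_iff]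
    refine ⟨fun r hr => (Finset.mem_filter.1 hr).2, fun r hr hrc => ?_⟩
    -- A rule of `S` still possible contains a rule of `S'` that is also possible; the latter is
    -- covered by a realized rule, and covering is transitive.
    obtain ⟨r', hr', hsub, hcov⟩ := hred.2 r hr
    rw [consistent_union_tupleEqs] at hrc
    have hfin := h2.finished
    rw [Finset.empty_union] at hfin
    obtain ⟨r₀, h4, h5, h6⟩ := exists_covers hC hfin hr' (by
      rw [consistent_union_tupleEqs, eqs_subset_adapt (fun _ _ => rfl) hr']
      exact fun e he => hrc e (hsub he))
    refine ⟨r₀, Finset.mem_filter.2 ⟨h4, ?_⟩, h6.trans hcov⟩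
    rwa [eqs_subset_tupleEqs, consistent_union_tupleEqs, eqs_subset_adapt (fun _ _ => rfl) h4,
      ← consistent_union_tupleEqs, ← eqs_subset_tupleEqs] at h5
  · obtain ⟨δ, hδ, -, -⟩ := exists_tuple (S := S) (ext := C.ext) (E := ∅) (by simp [Consistent])
      (by simp)
    have := depth_roundsTree hC hI hR hred.1 hext (maxLen (C.inner S')) N (maxLen (C.inner S'))
      [] δ hδ (by simp) le_rfl (by
        rw [List.toFinset_nil, tupleEqs_empty, restrict_empty])
    refine this.trans (le_of_eq ?_)
    ring

end tree

/-! ## The reduced systems -/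

theorem Problem.reduces_self (C : Problem) (S : Finset Rule) : C.Reduces S S :=
  ⟨Finset.Subset.refl _, fun r hr => ⟨r, hr, Finset.Subset.refl _, .refl C r⟩⟩

theorem mem_reduce_iff {C : Problem} (hC : C = .EAD ∨ C = .ESR) {S : Finset Rule} {r : Rule} :
    r ∈ C.reduce S ↔ r ∈ S ∧ ∀ r' ∈ S, C.Covers r' r → ¬ r'.lhs ⊂ r.lhs := by
  rcases hC with rfl | rfl
  · simp only [Problem.reduce, reduceAD, Finset.mem_filter, Problem.Covers]
  · simp only [Problem.reduce, reduceSR, Finset.mem_filter, Problem.Covers, true_imp_iff]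

/-- Descent: a rule outside the reduced system has a strictly shorter covering rule inside its
left-hand side, and lengths cannot decrease forever. -/
theorem reduces_reduce {C : Problem} (hC : C = .EAD ∨ C = .ESR) (S : Finset Rule) :
    C.Reduces S (C.reduce S) := by
  refine ⟨fun r hr => ((mem_reduce_iff hC).1 hr).1, ?_⟩
  suffices h : ∀ (n : ℕ) (r : Rule), r.length ≤ n → r ∈ S →
      ∃ r' ∈ C.reduce S, r'.lhs ⊆ r.lhs ∧ C.Covers r' r from fun r hr => h _ r le_rfl hr
  intro n
  induction n with
  | zero =>
    intro r hn hr
    refine ⟨r, (mem_reduce_iff hC).2 ⟨hr, fun r' _ _ hlt => ?_⟩, Finset.Subset.refl _, .refl C r⟩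
    have h1 := Finset.card_lt_card hlt
    have h2 : r.lhs.card ≤ 0 := hn
    omega
  | succ n ih =>
    intro r hn hr
    by_cases h : r ∈ C.reduce S
    · exact ⟨r, h, Finset.Subset.refl _, .refl C r⟩
    · rw [mem_reduce_iff hC] at h
      push Not at h
      obtain ⟨r', hr', hcov, hlt⟩ := h hr
      have h1 : r'.length < r.length := Finset.card_lt_card hlt
      obtain ⟨r'', h2, h3, h4⟩ := ih r' (by omega) hr'
      exact ⟨r'', h2, h3.trans hlt.1, h4.trans hcov⟩

theorem minimal_reduce {C : Problem} (hC : C = .EAD ∨ C = .ESR) (S : Finset Rule) :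
    C.Minimal S (C.reduce S) := by
  intro r hr r₀ hr₀ hsub hcov
  by_contra hne
  exact ((mem_reduce_iff hC).1 hr).2 r₀ hr₀ hcov (hsub.ssubset_of_ne hne)

/-! ## The algorithms for the problems -/

/-- The trees of the algorithm of a problem, for the given program of the algorithm. -/
theorem exists_describes {C : Problem} (hC : C.Basic) {R I : List WRule → List WRule}
    (hI : ∀ w T, Lists w T → Lists (I w) (C.inner T)) {p : Program} {q : Polynomial ℕ}
    (hp : ∀ x : List WRule × List Eqn,
      p.ComputesIn (enc x) (enc (algL R I x)) (q.eval (enc x).size))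
    {S S' : Finset Rule} {w : List WRule} (hw : Presents w S) (hR : Lists (R w) S')
    (hRw : (R w).Sublist w) (hred : C.Reduces S S') (hext : C.ext = true ∨ S' = S)
    {run : (ℕ → Option ℕ) → List ℕ → Finset Rule → Prop} {κ : (ℕ → Option ℕ) → ℕ → Option ℕ}
    (hκ : ∀ δ, IsTuple S C.ext δ → ∀ a ∈ attributes S', κ δ a = adapt S' δ a)
    (hrun : ∀ δ s, Rounds C.inner S' (κ δ) ∅ s → run δ s (S'.filter fun r =>
      Consistent (r.eqs ∪ tupleEqs (κ δ) s.toFinset) ∧ r.attrs ⊆ s.toFinset)) :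
    ∃ Γ : DTree S C.ext, Describes p q w Γ run ∧ Γ.Solves C ∧
      Γ.depth ≤ maxLen (C.inner S') ^ 2 * betaPlus C S' := by
  obtain ⟨Γ, h1, h2, h3⟩ := exists_tree (R := R) hC hI hw hR hRw hred hext
  refine ⟨Γ, fun δ hδ => ?_, h2, h3⟩
  obtain ⟨s, τ, out, g1, g2, rfl, g4, g5⟩ := h1 δ hδ (κ δ) (hκ δ hδ)
  refine ⟨s, _, out, g1, hrun δ s g2, g4, ?_⟩
  have := hp (w, tupleList S δ)
  rw [g5] at this
  exact this

/-- The trees attach the realized rules, the procedure returns the consistent ones. At the end these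
agree, because covering is equality for `AR` and `EAR`. -/
theorem arun_of_rounds {C : Problem} (hC : C = .AR ∨ C = .EAR) {S : Finset Rule}
    {δ : ℕ → Option ℕ} {s : List ℕ} (h : Rounds C.inner S δ ∅ s) :
    ARun S δ s (S.filter fun r =>
      Consistent (r.eqs ∪ tupleEqs δ s.toFinset) ∧ r.attrs ⊆ s.toFinset) := by
  have hB : C.Basic := by rcases hC with rfl | rfl <;> simp [Problem.Basic]
  have hid : C.inner = fun T => T := by rcases hC with rfl | rfl <;> rfl
  have hcov : ∀ r r', C.Covers r r' → r = r' := by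
    rcases hC with rfl | rfl <;> simp [Problem.Covers]
  refine ⟨hid ▸ h, Finset.filter_congr fun r hr => ⟨fun h => h.1, fun hc => ⟨hc, ?_⟩⟩⟩
  have hfin := h.finished
  rw [Finset.empty_union] at hfin
  obtain ⟨r₀, -, h1, h2⟩ := exists_covers hB hfin hr hc
  rw [hcov _ _ h2] at h1
  exact (eqs_subset_tupleEqs.1 h1).2

theorem adapt_self {S : Finset Rule} {ext : Bool} {δ : ℕ → Option ℕ} (hδ : IsTuple S ext δ) :
    ∀ a ∈ attributes S, δ a = adapt S δ a := by
  intro a ha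
  have h := hδ a ha
  rw [adapt, if_pos]
  rw [mem_values] at h ⊢
  exact h.imp id fun h => ⟨rfl, h.2⟩

theorem exists_greedyCover_program :
    ∃ (p : Program) (q : Polynomial ℕ), ∀ (S : Finset Rule) (w : List (List (ℕ × ℕ) × ℕ)),
      (attributes S).Nonempty → Presents w S →
      ∃ b : List ℕ, b.Nodup ∧ GreedyCover (plus S) b.toFinset ∧
        p.ComputesIn (encRules w) (encList encNat b) (q.eval (encRules w).size) := by
  obtain ⟨p, q, hp⟩ := PolyTime.computesIn
    (PolyTime.coverL (PolyTime.plusL (PolyTime.id (α := List WRule))))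
  refine ⟨p, q, fun S w hne hw => ?_⟩
  obtain ⟨a, ha⟩ := hne
  obtain ⟨r, hr, har⟩ := Finset.mem_biUnion.1 ha
  have hpos : 0 < maxLen S := lt_of_lt_of_le
    (by rw [← Rule.card_attrs]; exact Finset.card_pos.2 ⟨a, har⟩) (length_le_maxLen hr)
  obtain ⟨h1, h2⟩ := greedyCover_coverL hw.lists.plusL fun r hr => by
    rw [← Finset.card_pos, Rule.card_attrs, (Finset.mem_filter.1 hr).2]
    exact hpos
  exact ⟨coverL (plusL w), h1, h2, hp w⟩

theorem exists_ar_program {C : Problem} (hC : C = .AR ∨ C = .EAR) :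
    ∃ (p : Program) (q : Polynomial ℕ), ∀ (S : Finset Rule) (w : List (List (ℕ × ℕ) × ℕ)),
      (attributes S).Nonempty → Presents w S →
      ∃ Γ : DTree S C.ext, Describes p q w Γ (ARun S) ∧ Γ.Solves C ∧
        Γ.depth ≤ maxLen S ^ 2 * betaPlus C S ∧ Γ.depth ≤ minDepth C S ^ 3 := by
  have hB : C.Basic := by rcases hC with rfl | rfl <;> simp [Problem.Basic]
  have hid : C.inner = fun T => T := by rcases hC with rfl | rfl <;> rfl
  have hcov : ∀ r r', C.Covers r r' → r = r' := by
    rcases hC with rfl | rfl <;> simp [Problem.Covers]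
  obtain ⟨p, q, hp⟩ := PolyTime.computesIn
    (PolyTime.algL (PolyTime.id (α := List WRule)) (PolyTime.id (α := List WRule)))
  refine ⟨p, q, fun S w _ hw => ?_⟩
  obtain ⟨Γ, h1, h2, h3⟩ := exists_describes (R := fun w => w) (I := fun w => w) hB
    (fun w T h => by rw [hid]; exact h) hp hw hw.lists (List.Sublist.refl w) (C.reduces_self S)
    (.inr rfl) (κ := fun δ => δ) (fun δ hδ => adapt_self hδ) fun δ s h => arun_of_rounds hC h
  refine ⟨Γ, h1, h2, by rwa [hid] at h3, le_minDepth_cube hB (C.reduces_self S) ?_ h2 h3⟩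
  intro r _ r₀ _ _ hc
  rw [hcov _ _ hc]

theorem basic_of_inner {C : Problem} (hC : C = .EAD ∨ C = .ESR) : C.Basic := by
  rcases hC with rfl | rfl <;> simp [Problem.Basic]

theorem exists_inner_function {C : Problem} (hC : C = .EAD ∨ C = .ESR) :
    ∃ I : List WRule → List WRule, PolyTime I ∧ ∀ w T, Lists w T → Lists (I w) (C.inner T) := by
  rcases hC with rfl | rfl
  · exact ⟨innerADL, PolyTime.innerADL, fun w T h => h.innerADL⟩
  · exact ⟨innerSRL, PolyTime.innerSRL, fun w T h => h.innerSRL⟩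

theorem exists_reduce_function {C : Problem} (hC : C = .EAD ∨ C = .ESR) :
    ∃ R : List WRule → List WRule, PolyTime R ∧ (∀ w, (R w).Sublist w) ∧
      ∀ w T, Lists w T → Lists (R w) (C.reduce T) := by
  rcases hC with rfl | rfl
  · exact ⟨reduceADL, PolyTime.reduceADL, fun w => List.filter_sublist, fun w T h => h.reduceADL⟩
  · exact ⟨reduceSRL, PolyTime.reduceSRL, fun w => List.filter_sublist, fun w T h => h.reduceSRL⟩

theorem exists_brun_program {C : Problem} (hC : C = .EAD ∨ C = .ESR) :
    ∃ (p : Program) (q : Polynomial ℕ), ∀ (S : Finset Rule) (w : List (List (ℕ × ℕ) × ℕ)),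
      (attributes S).Nonempty → Presents w S →
      ∃ Γ : DTree S C.ext, Describes p q w Γ (BRun C S) ∧ Γ.Solves C ∧
        Γ.depth ≤ maxLen (C.inner S) ^ 2 * betaPlus C S := by
  obtain ⟨I, hI, hI'⟩ := exists_inner_function hC
  obtain ⟨p, q, hp⟩ := PolyTime.computesIn (PolyTime.algL (PolyTime.id (α := List WRule)) hI)
  refine ⟨p, q, fun S w _ hw => ?_⟩
  exact exists_describes (R := fun w => w) (basic_of_inner hC) hI' hp hw hw.lists
    (List.Sublist.refl w) (C.reduces_self S) (.inr rfl) (κ := fun δ => δ)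
    (fun δ hδ => adapt_self hδ) fun δ s h => ⟨h, rfl⟩

theorem exists_reduced_brun_program {C : Problem} (hC : C = .EAD ∨ C = .ESR) :
    ∃ (p : Program) (q : Polynomial ℕ), ∀ (S : Finset Rule) (w : List (List (ℕ × ℕ) × ℕ)),
      (attributes S).Nonempty → Presents w S →
      ∃ Γ : DTree S C.ext,
        Describes p q w Γ (fun δ => BRun C (C.reduce S) (adapt (C.reduce S) δ)) ∧ Γ.Solves C ∧
        Γ.depth ≤ maxLen (C.inner (C.reduce S)) ^ 2 * betaPlus C (C.reduce S) ∧
        Γ.depth ≤ minDepth C S ^ 3 := by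
  obtain ⟨I, hI, hI'⟩ := exists_inner_function hC
  obtain ⟨R, hR, hR', hR''⟩ := exists_reduce_function hC
  obtain ⟨p, q, hp⟩ := PolyTime.computesIn (PolyTime.algL hR hI)
  refine ⟨p, q, fun S w _ hw => ?_⟩
  obtain ⟨Γ, h1, h2, h3⟩ := exists_describes (basic_of_inner hC) hI' hp hw (hR'' w S hw.lists)
    (hR' w) (reduces_reduce hC S) (.inl (by rcases hC with rfl | rfl <;> rfl))
    (run := fun δ => BRun C (C.reduce S) (adapt (C.reduce S) δ))
    (κ := fun δ => adapt (C.reduce S) δ) (fun δ _ a _ => rfl) fun δ s h => ⟨h, rfl⟩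
  exact ⟨Γ, h1, h2, h3, le_minDepth_cube (basic_of_inner hC) (reduces_reduce hC S)
    (minimal_reduce hC S) h2 h3⟩

theorem Problem.accepts_ad_and_sr {S : Finset Rule} {K : EqSystem} {τ : Finset Rule}
    (h : Problem.AR.Accepts S K τ) : Problem.AD.Accepts S K τ ∧ Problem.SR.Accepts S K τ := by
  rw [Problem.accepts_iff] at h
  have h' : ∀ r ∈ S, Consistent (r.eqs ∪ K) → r ∈ τ := fun r hr hc => by
    obtain ⟨r₀, h0, rfl⟩ := h.2 r hr hc
    exact h0
  exact ⟨Problem.accepts_iff.2 ⟨h.1, fun r hr hc => ⟨r, h' r hr hc, rfl⟩⟩,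
    Problem.accepts_iff.2 ⟨h.1, fun r hr hc => ⟨r, h' r hr hc, trivial⟩⟩⟩

end DecisionRules

/-! ### The main theorem. -/

theorem mainTheorem5 :
    -- every greedy cover of `S⁺` is a node cover within the factor `d(S)` of the optimum
    (∀ S : Finset Rule, (attributes S).Nonempty → ∀ B : Finset ℕ, GreedyCover (plus S) B →
      IsNodeCover (plus S) B ∧ B.card ≤ coverNumber (plus S) * maxLen S) ∧
    -- and a greedy cover is constructed in polynomial time
    (∃ (p : Program) (q : Polynomial ℕ), ∀ (S : Finset Rule) (w : List (List (ℕ × ℕ) × ℕ)),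
      (attributes S).Nonempty → Presents w S →
      ∃ b : List ℕ, b.Nodup ∧ GreedyCover (plus S) b.toFinset ∧
        p.ComputesIn (encRules w) (encList encNat b) (q.eval (encRules w).size)) ∧
    -- problems `AR`, `AD`, `SR`: one algorithm
    (∃ (p : Program) (q : Polynomial ℕ), ∀ (S : Finset Rule) (w : List (List (ℕ × ℕ) × ℕ)),
      (attributes S).Nonempty → Presents w S →
      ∃ Γ : DTree S false,
        Describes p q w Γ (ARun S) ∧
        (Γ.Solves .AR ∧ Γ.depth ≤ maxLen S ^ 2 * betaPlus .AR S ∧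
          Γ.depth ≤ minDepth .AR S ^ 3) ∧
        (Γ.Solves .AD ∧ Γ.depth ≤ maxLen S ^ 2 * betaPlus .AD S) ∧
        (Γ.Solves .SR ∧ Γ.depth ≤ maxLen S ^ 2 * betaPlus .SR S)) ∧
    -- problem `EAR`
    (∃ (p : Program) (q : Polynomial ℕ), ∀ (S : Finset Rule) (w : List (List (ℕ × ℕ) × ℕ)),
      (attributes S).Nonempty → Presents w S →
      ∃ Γ : DTree S true,
        Describes p q w Γ (ARun S) ∧ Γ.Solves .EAR ∧
        Γ.depth ≤ maxLen S ^ 2 * betaPlus .EAR S ∧ Γ.depth ≤ minDepth .EAR S ^ 3) ∧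
    -- problems `EAD`, `ESR`
    (∀ C : Problem, C = .EAD ∨ C = .ESR →
      -- the algorithm applied to the system `S` itself
      (∃ (p : Program) (q : Polynomial ℕ), ∀ (S : Finset Rule) (w : List (List (ℕ × ℕ) × ℕ)),
        (attributes S).Nonempty → Presents w S →
        ∃ Γ : DTree S true,
          Describes p q w Γ (BRun C S) ∧ Γ.Solves C ∧
          Γ.depth ≤ maxLen (C.inner S) ^ 2 * betaPlus C S) ∧
      -- the algorithm applied to the reduced system and adapted to the tuples from `EV(S)`
      (∃ (p : Program) (q : Polynomial ℕ), ∀ (S : Finset Rule) (w : List (List (ℕ × ℕ) × ℕ)),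
        (attributes S).Nonempty → Presents w S →
        ∃ Γ : DTree S true,
          Describes p q w Γ
            (fun δ => BRun C (C.reduce S) (adapt (C.reduce S) δ)) ∧ Γ.Solves C ∧
          Γ.depth ≤ maxLen (C.inner (C.reduce S)) ^ 2 * betaPlus C (C.reduce S) ∧
          Γ.depth ≤ minDepth C S ^ 3)) := by
  refine ⟨fun S _ B hB => ⟨hB.isNodeCover, hB.card_le_coverNumber⟩, exists_greedyCover_program,
    ?_, exists_ar_program (.inr rfl), fun C hC => ?_⟩
  · obtain ⟨p, q, h⟩ := exists_ar_program (C := .AR) (.inl rfl)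
    refine ⟨p, q, fun S w hne hw => ?_⟩
    obtain ⟨Γ, h1, h2, h3, h4⟩ := h S w hne hw
    -- The same `h3` serves three times: for `AR`, `AD` and `SR` the operator `I_C` is the identity
    -- and the value sets agree, so `betaPlus` is the same number by definition.
    exact ⟨Γ, h1, ⟨h2, h3, h4⟩,
      ⟨⟨rfl, fun ξ τ hξ hc => (Problem.accepts_ad_and_sr (h2.2 ξ τ hξ hc)).1⟩, h3⟩,
      ⟨⟨rfl, fun ξ τ hξ hc => (Problem.accepts_ad_and_sr (h2.2 ξ τ hξ hc)).2⟩, h3⟩⟩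
  · have h1 := exists_brun_program hC
    have h2 := exists_reduced_brun_program hC
    rcases hC with rfl | rfl
    · exact ⟨h1, h2⟩
    · exact ⟨h1, h2⟩
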